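/- Let $F$ be a quadratically closed field (characteristic different from $2$, every element a square). Let $\mathcal L_\bullet(F)=\bigoplus_{n\ge 1}\mathcal L_n(F)$ be Goncharov's Lie coalgebra of formal polylogarithms: $\mathcal L_n(F)$ is the $\mathbb Q$-vector space generated by correlators $\mathrm{Cor}(x_0,\dots,x_n)$, $x_i\in F$, with cobracket $$\Delta\,\mathrm{Cor}(x_0,\dots,x_n)=\sum_{j\in\mathbb Z/(n+1)}\ \sum_{i=1}^{n-1}\mathrm{Cor}(x_j,x_{j+1},\dots,x_{j+i})\wedge \mathrm{Cor}(x_j,x_{j+i+1},\dots,x_{j+n}),$$ modulo functional equations, which are defined inductively in $n$. For $n=1$, $\mathrm{Cor}(x,y)=\log(y-x)$ and $\mathcal L_1(F)=F^\times\otimes\mathbb Q$ (with $\log 0=0$). For $n\ge2$ they are affine invariance, cyclic symmetry, the shuffle relations $\sum_{w}\mathrm{Cor}(x,w)=0$ (sum over all shuffles $w$ of two nonempty words $u,v$), and $\alpha|_{t=a}-\alpha|_{t=b}$ for every combination $\alpha$ of correlators of weight $n$ over $F(t)$ with $\Delta\alpha=0$ and all $a,b\in F$; here a correlator over $F(t)$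 is specialized by an affine change of its entries after which they are regular at the point and do not all have the same value there (unless they are all equal), followed by evaluation. (All these functional equations are imposed as elements with zero cobracket modulo the equations of lower weight.) In particular, products of polylogarithms of lower weight vanish in $\mathcal L_\bullet(F)$, so that equality in $\mathcal L_n(F)$ means equality modulo such products. For $n_0\ge0$, $n_1,\dots,n_d\ge1$ and $a_1,\dots,a_d\in F^\times$ put $$\mathrm{Li}^{\mathcal L}_{n_0;n_1,\dots,n_d}(a_1,\dots,a_d)=(-1)^d\,I(0;\underbrace{0,\dots,0}_{n_0},1,\underbrace{0,\dots,0}_{n_1-1},a_1,\underbrace{0,\dots,0}_{n_2-1},a_1a_2,\dots,a_1\cdots a_{d-1},\underbrace{0,\dots,0}_{n_d-1};a_1\cdots a_d),$$ where $I(x;w_1,\dots,w_n;y)=\mathrm{Cor}(w_1,\dots,w_n,y)-\mathrm{Cor}(x,w_1,\dots,w_n)$. This is the formal multiple polylogarithm of depth $d$ and weight $n_0+n_1+\dots+n_d$; for $n_0=0$ it corresponds to the function $\mathrm{Li}_{n_1,\dots,n_d}(a_1,\dots,a_d)$. Let $\mathcal D_d\mathcal L_\bullet(F)$ be the span of the multiple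 polylogarithms of depth between $1$ and $d$ (so $\mathcal D_0=0$), let $\mathcal B_n(F)\subseteq\mathcal L_n(F)$ be the span of the $\mathrm{Li}^{\mathcal L}_{0;n}(a)$, let $\overline\Delta$ be $\Delta$ with the components in $\mathcal L_1\wedge\mathcal L_{n-1}$ omitted, and let $\overline\Delta^{[k]}$ be its $k$-th iteration ($\overline\Delta^{[0]}=\mathrm{id}$). Assume Goncharov's depth conjecture for $F$: for all $d\geq 0$, an element $x\in\mathcal L_\bullet(F)$ lies in $\mathcal D_d\mathcal L_\bullet(F)$ if and only if $\overline\Delta^{[d]}(x)=0$; and for all $d\ge1$ the map $\overline\Delta^{[d-1]}$ induces an isomorphism from $\mathrm{gr}^{\mathcal D}_d\mathcal L_{\ge2}(F)$ onto the degree $d$ component $\mathrm{coLie}_d\big(\bigoplus_{n\ge2}\mathcal B_n(F)\big)$ of the cofree Lie coalgebra. Then: 1. For every $n$, the space $\mathcal L_n(F)$ is spanned by the elements $\mathrm{Li}^{\mathcal L}_{n-d;1,\dots,1}(a_1,\dots,a_d)$ with $1\le d\le n$ and $a_1,\dots,a_d\in F^\times$. 2. For all $1\le d\le n$ and $a_1,\dots,a_d\in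 F^\times$, the element $\mathrm{Li}^{\mathcal L}_{n-d;1,\dots,1}(a_1,\dots,a_d)$ is a $\mathbb Q$-linear combination of elements $\mathrm{Li}^{\mathcal L}_{0;n-d+1,1,\dots,1}(b_1,\dots,b_d)$, $b_i\in F^\times$, and of multiple polylogarithms of weight $n$ and depth at most $d-1$. 3. Consequently every multiple polylogarithm $\mathrm{Li}^{\mathcal L}_{n_0;n_1,\dots,n_d}(a_1,\dots,a_d)$ of weight $n$ and depth $d\ge1$ can be expressed in $\mathcal L_n(F)$, that is, modulo products of polylogarithms of lower weight, through the functions $\mathrm{Li}_{n-d+1,1,\dots,1}$ and their analogues of lower depth: it is a $\mathbb Q$-linear combination of elements $\mathrm{Li}^{\mathcal L}_{0;n-e+1,1,\dots,1}(b_1,\dots,b_e)$ with $1\le e\le d$ and $b_1,\dots,b_e\in F^\times$. -/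

import Mathlib

open scoped TensorProduct

universe u

namespace FormalPolylog

noncomputable section

/-! ## Symbols of correlators and their cobracket -/

/-- The rational vector space freely generated by symbols `Cor(x₀, …, xₙ)` with entries in `F`,
a symbol being the list of its entries.  The symbol `Cor(x₀, …, xₙ)` has weight `n`. -/
abbrev Symb (F : Type u) : Type u := List F →₀ ℚ

/-- The symbol `Cor(l)`. -/
def gen {F : Type u} (l : List F) : Symb F := Finsupp.single l 1

/-- The span of the symbols of weight `n`, that is, with `n + 1` entries. -/
def homog (F : Type u) (n : ℕ) : Submodule ℚ (Symb F) :=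
  Finsupp.supported ℚ ℚ {l : List F | l.length = n + 1}

/-- `x ∧ y`, as an antisymmetric tensor. -/
def wedge {V : Type u} [AddCommGroup V] [Module ℚ V] (x y : V) : V ⊗[ℚ] V :=
  x ⊗ₜ[ℚ] y - y ⊗ₜ[ℚ] x

/-- `Cor(x₀, x₁, …, xᵢ) ∧ Cor(x₀, xᵢ₊₁, …, xₙ)`. -/
def cut {F : Type u} (i : ℕ) : List F → Symb F ⊗[ℚ] Symb F
  | [] => 0
  | x :: xs => wedge (gen (x :: xs.take i)) (gen (x :: xs.drop i))

/-- Goncharov's cobracket of a correlator: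
`Δ Cor(x₀, …, xₙ) = ∑_{j} ∑_{i = 1}^{n - 1}
  Cor(xⱼ, xⱼ₊₁, …, xⱼ₊ᵢ) ∧ Cor(xⱼ, xⱼ₊ᵢ₊₁, …, xⱼ₊ₙ)`, the indices being taken modulo `n + 1`. -/
def cobracketGen {F : Type u} (l : List F) : Symb F ⊗[ℚ] Symb F :=
  ∑ j ∈ Finset.range l.length, ∑ i ∈ Finset.Ico 1 (l.length - 1), cut i (l.rotate j)

/-- The linear extension of `cobracketGen`. -/
def symbCobracket (F : Type u) : Symb F →ₗ[ℚ] Symb F ⊗[ℚ] Symb F :=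
  Finsupp.linearCombination ℚ cobracketGen

/-- The image of the cobracket of `r` in `∧² (Symb F ⧸ R)` (as an antisymmetric tensor). -/
def cobracketMod {F : Type u} (R : Submodule ℚ (Symb F)) :
    Symb F →ₗ[ℚ] (Symb F ⧸ R) ⊗[ℚ] (Symb F ⧸ R) :=
  TensorProduct.map R.mkQ R.mkQ ∘ₗ symbCobracket F

/-! ## The relations -/

/-- All shuffles of two words, with multiplicity. -/
def shuffles {α : Type u} : List α → List α → List (List α)
  | [], v => [v]
  | a :: u, [] => [a :: u]
  | a :: u, b :: v =>
      (shuffles u (b :: v)).map (a :: ·) ++ (shuffles (a :: u) v).map (b :: ·)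
termination_by u v => u.length + v.length

/-- Relations in weight at most one: there is nothing in weight zero, and `Cor(x, y)` is
`log (y - x)`, so that the weight one part becomes `Fˣ ⊗ ℚ`, with the convention `log 0 = 0`. -/
inductive LogRelation {F : Type u} [Field F] : Symb F → Prop
  | short (l : List F) (hl : l.length ≤ 1) : LogRelation (gen l)
  | diag (x : F) : LogRelation (gen [x, x])
  | transl (x y : F) : LogRelation (gen [x, y] - gen [0, y - x])
  | mul (a b : F) (ha : a ≠ 0) (hb : b ≠ 0) :
      LogRelation (gen [0, a * b] - gen [0, a] - gen [0, b])

/-- The elementary functional equations of correlators of weight at least two: invariance under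
affine transformations, cyclic symmetry, and the shuffle relations
`∑_{w ∈ u ⧢ v} Cor(x, w) = 0` for nonempty `u`, `v`. -/
inductive ElementaryRelation {F : Type u} [Field F] : Symb F → Prop
  | transl (c : F) (l : List F) : ElementaryRelation (gen (l.map (· + c)) - gen l)
  | scale (c : F) (hc : c ≠ 0) (l : List F) : ElementaryRelation (gen (l.map (c * ·)) - gen l)
  | cyclic (l : List F) : ElementaryRelation (gen (l.rotate 1) - gen l)
  | shuffle (x : F) (u v : List F) (hu : u ≠ []) (hv : v ≠ []) :
      ElementaryRelation ((shuffles u v).map fun w => gen (x :: w)).sum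

/-- The rational function `g` is regular at `a`, with value `y`. -/
def HasValueAt {F : Type u} [Field F] (a : F) (g : RatFunc F) (y : F) : Prop :=
  g.denom.eval a ≠ 0 ∧ g.eval (RingHom.id F) a = y

/-- All entries of a list are equal. -/
def AllEqual {α : Type u} (l : List α) : Prop := ∃ y, ∀ z ∈ l, z = y

/-- `Cor(x)` is a specialization at `t = a` of the correlator `Cor(f)` with entries in `F(t)`:
after an affine transformation all entries of `f` are regular at `a` and have the values `x`, where
these values are not all equal unless the entries of `f` are.  In weight at least two, every
correlator has a specialization, and it is unique up to affine transformations. -/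
def Specializes {F : Type u} [Field F] (a : F) (f : List (RatFunc F)) (x : List F) : Prop :=
  (∃ c v : RatFunc F, v ≠ 0 ∧ List.Forall₂ (fun g y => HasValueAt a (v * (g - c)) y) f x) ∧
    (AllEqual x → AllEqual f)

/-- The functional equations of weight `n` obtained by specialization: if a combination
`α` of correlators over `F(t)` has cobracket zero modulo the relations `R'` over `F(t)`, then it is
constant, that is, its specializations at any two points `a` and `b` agree. -/
def SpecializationRelation {F : Type u} [Field F] (n : ℕ)
    (R' : Submodule ℚ (Symb (RatFunc F))) (r : Symb F) : Prop :=
  ∃ (α : Symb (RatFunc F)) (a b : F) (s s' : List (RatFunc F) → List F),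
    α ∈ homog (RatFunc F) n ∧ cobracketMod R' α = 0 ∧
    (∀ l ∈ α.support, Specializes a l (s l) ∧ Specializes b l (s' l)) ∧
    r = α.mapDomain s - α.mapDomain s'

/-- One step of the inductive construction: the relations of weight `n`, given the relations `R`
over `F` and `R'` over `F(t)` in all smaller weights.  (The functional equations have cobracket
zero modulo `R`; this is recorded in the definition, which makes the relations a coideal.) -/
def relStep {F : Type u} [Field F] (n : ℕ) (R : Submodule ℚ (Symb F))
    (R' : Submodule ℚ (Symb (RatFunc F))) : Submodule ℚ (Symb F) :=
  Submodule.span ℚ {r | r ∈ homog F n ∧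
    (ElementaryRelation r ∨ SpecializationRelation n R' r) ∧ cobracketMod R r = 0}

/-- The relations of weight at most `n + 1`, by induction on `n`, for all fields at once. -/
def rel : ℕ → ∀ (F : Type u) [Field F], Submodule ℚ (Symb F)
  | 0, F, _ => Submodule.span ℚ {r : Symb F | LogRelation r}
  | n + 1, F, _ => rel n F ⊔ relStep (n + 2) (rel n F) (rel n (RatFunc F))

/-- All relations. -/
def allRel (F : Type u) [Field F] : Submodule ℚ (Symb F) := ⨆ n, rel n F

/-! ## The Lie coalgebra of formal polylogarithms -/

/-- The Lie coalgebra `ℒ_•(F)` of formal polylogarithms with values in `F`. -/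
abbrev Polylog (F : Type u) [Field F] : Type u := Symb F ⧸ allRel F

/-- The element of `ℒ_•(F)` given by a correlator. -/
def cor {F : Type u} [Field F] (l : List F) : Polylog F := (allRel F).mkQ (gen l)

/-- The component `ℒ_n(F)` of weight `n`. -/
def weightPart (F : Type u) [Field F] (n : ℕ) : Submodule ℚ (Polylog F) :=
  (homog F n).map (allRel F).mkQ

theorem cobracketGen_of_short {F : Type u} (l : List F) (hl : l.length ≤ 2) :
    cobracketGen l = 0 := by
  unfold cobracketGen
  refine Finset.sum_eq_zero fun j _ => ?_
  rw [Finset.Ico_eq_empty (by omega), Finset.sum_empty]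

theorem symbCobracket_gen {F : Type u} (l : List F) :
    symbCobracket F (gen l) = cobracketGen l := by
  simp [symbCobracket, gen]

theorem cobracketMod_eq_zero_of_le {F : Type u} {R S : Submodule ℚ (Symb F)} (h : R ≤ S)
    {r : Symb F} (hr : cobracketMod R r = 0) : cobracketMod S r = 0 := by
  have key : cobracketMod S
      = TensorProduct.map (Submodule.factor h) (Submodule.factor h) ∘ₗ cobracketMod R := by
    unfold cobracketMod
    rw [← LinearMap.comp_assoc, ← TensorProduct.map_comp, Submodule.factor_comp_mk]
  rw [key, LinearMap.comp_apply, hr, map_zero]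

theorem symbCobracket_of_logRelation {F : Type u} [Field F] {r : Symb F} (h : LogRelation r) :
    symbCobracket F r = 0 := by
  cases h with
  | short l hl => rw [symbCobracket_gen, cobracketGen_of_short l (by omega)]
  | diag x => rw [symbCobracket_gen, cobracketGen_of_short _ (by simp)]
  | transl x y =>
    rw [map_sub, symbCobracket_gen, symbCobracket_gen, cobracketGen_of_short _ (by simp),
      cobracketGen_of_short _ (by simp), sub_zero]
  | mul a b ha hb =>
    rw [map_sub, map_sub, symbCobracket_gen, symbCobracket_gen, symbCobracket_gen,
      cobracketGen_of_short _ (by simp), cobracketGen_of_short _ (by simp),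
      cobracketGen_of_short _ (by simp), sub_zero, sub_zero]

theorem rel_le_ker (F : Type u) [Field F] (n : ℕ) :
    rel n F ≤ LinearMap.ker (cobracketMod (allRel F)) := by
  induction n with
  | zero =>
    rw [rel, Submodule.span_le]
    intro r hr
    simp only [SetLike.mem_coe, LinearMap.mem_ker, cobracketMod, LinearMap.comp_apply]
    rw [symbCobracket_of_logRelation hr, map_zero]
  | succ n ih =>
    rw [rel]
    refine sup_le ih ?_
    rw [relStep, Submodule.span_le]
    rintro r ⟨-, -, hr⟩
    exact cobracketMod_eq_zero_of_le (le_iSup (fun n => rel n F) n) hr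

/-- The cobracket `Δ : ℒ_•(F) → ∧² ℒ_•(F)`, with values in antisymmetric tensors. -/
def cobracket (F : Type u) [Field F] : Polylog F →ₗ[ℚ] Polylog F ⊗[ℚ] Polylog F :=
  (allRel F).liftQ (cobracketMod (allRel F)) (iSup_le (rel_le_ker F))

/-- On symbols, the projection that omits the weights zero and one. -/
def symbTrunc (F : Type u) : Symb F →ₗ[ℚ] Symb F :=
  Finsupp.linearCombination ℚ fun l => if 3 ≤ l.length then gen l else 0

theorem symbTrunc_gen_of_short {F : Type u} (l : List F) (hl : l.length ≤ 2) :
    symbTrunc F (gen l) = 0 := by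
  have h : ¬ 3 ≤ l.length := by omega
  simp [symbTrunc, gen, h]

theorem symbTrunc_of_homog {F : Type u} (n : ℕ) {r : Symb F} (hr : r ∈ homog F (n + 2)) :
    symbTrunc F r = r := by
  have h : ∀ l ∈ r.support, l.length = n + 2 + 1 := fun l hl => hr hl
  rw [symbTrunc, Finsupp.linearCombination_apply]
  conv_rhs => rw [← Finsupp.sum_single r]
  refine Finsupp.sum_congr fun l hl => ?_
  have h3 : 3 ≤ l.length := by have := h l hl; omega
  simp [h3, gen]

theorem symbTrunc_of_logRelation {F : Type u} [Field F] {r : Symb F} (h : LogRelation r) :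
    symbTrunc F r = 0 := by
  cases h with
  | short l hl => exact symbTrunc_gen_of_short l (by omega)
  | diag x => exact symbTrunc_gen_of_short _ (by simp)
  | transl x y =>
    rw [map_sub, symbTrunc_gen_of_short _ (by simp), symbTrunc_gen_of_short _ (by simp), sub_zero]
  | mul a b ha hb =>
    rw [map_sub, map_sub, symbTrunc_gen_of_short _ (by simp),
      symbTrunc_gen_of_short _ (by simp), symbTrunc_gen_of_short _ (by simp), sub_zero, sub_zero]

theorem rel_le_comap_symbTrunc (F : Type u) [Field F] (n : ℕ) :
    rel n F ≤ (rel n F).comap (symbTrunc F) := by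
  induction n with
  | zero =>
    rw [rel, Submodule.span_le]
    intro r hr
    rw [SetLike.mem_coe, Submodule.mem_comap, symbTrunc_of_logRelation hr]
    exact zero_mem _
  | succ n ih =>
    rw [rel]
    refine sup_le (ih.trans (Submodule.comap_mono le_sup_left)) ?_
    refine le_trans ?_ (Submodule.comap_mono le_sup_right)
    intro r hr
    have hle : relStep (n + 2) (rel n F) (rel n (RatFunc F)) ≤ homog F (n + 2) := by
      rw [relStep, Submodule.span_le]
      rintro r ⟨hr, -⟩
      exact hr
    rw [Submodule.mem_comap, symbTrunc_of_homog n (hle hr)]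
    exact hr

theorem allRel_le_comap_symbTrunc (F : Type u) [Field F] :
    allRel F ≤ (allRel F).comap (symbTrunc F) :=
  iSup_le fun n => (rel_le_comap_symbTrunc F n).trans
    (Submodule.comap_mono (le_iSup (fun n => rel n F) n))

/-- The projection `ℒ_•(F) → ℒ_{≥ 2}(F) ⊆ ℒ_•(F)`. -/
def trunc (F : Type u) [Field F] : Polylog F →ₗ[ℚ] Polylog F :=
  (allRel F).mapQ (allRel F) (symbTrunc F) (allRel_le_comap_symbTrunc F)

/-- The truncated cobracket: the component `ℒ₁ ∧ ℒ_{n-1}` of the cobracket is omitted. -/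
def truncCobracket (F : Type u) [Field F] : Polylog F →ₗ[ℚ] Polylog F ⊗[ℚ] Polylog F :=
  TensorProduct.map (trunc F) (trunc F) ∘ₗ cobracket F

/-- The iterated truncated cobracket `Δ̄^[k] : ℒ_•(F) → ℒ_•(F)^{⊗ (k + 1)}`, with values in the
component of degree `k + 1` of the tensor algebra: `Δ̄^[0]` is the identity and
`Δ̄^[k + 1] = (Δ̄^[k] ⊗ id) ∘ Δ̄`. -/
def iterCobracket (F : Type u) [Field F] : ℕ → (Polylog F →ₗ[ℚ] TensorAlgebra ℚ (Polylog F))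
  | 0 => TensorAlgebra.ι ℚ
  | k + 1 => LinearMap.mul' ℚ (TensorAlgebra ℚ (Polylog F)) ∘ₗ
      TensorProduct.map (iterCobracket F k) (TensorAlgebra.ι ℚ) ∘ₗ truncCobracket F

/-! ## Cofree Lie coalgebras -/

/-- The iterated cobracket of the word `v₀ v₁ ⋯ v_k` in the cofree Lie coalgebra of words modulo
shuffles, whose cobracket is deconcatenation `w ↦ ∑_{w = w' w''} w' ∧ w''`. -/
def coLieWord {L : Type u} [AddCommGroup L] [Module ℚ L] :
    (k : ℕ) → (Fin (k + 1) → L) → TensorAlgebra ℚ L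
  | 0, v => TensorAlgebra.ι ℚ (v 0)
  | k + 1, v => coLieWord k (Fin.init v) * TensorAlgebra.ι ℚ (v (Fin.last (k + 1)))
      - coLieWord k (Fin.tail v) * TensorAlgebra.ι ℚ (v 0)

/-- The component `coLie_d(V)` of degree `d ≥ 1` of the cofree Lie coalgebra cogenerated by a
subspace `V` of `L`.  This is the quotient of `V^{⊗ d}` by the shuffles; as the
iterated cobracket (the transpose of the iterated bracket `V^{⊗ d} → Lie_d(V)`) has the shuffles as
its kernel, it is realized here inside the degree `d` part of the tensor algebra as the image of the
iterated cobracket. -/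
def coLie {L : Type u} [AddCommGroup L] [Module ℚ L] (d : ℕ) (V : Submodule ℚ L) :
    Submodule ℚ (TensorAlgebra ℚ L) :=
  Submodule.span ℚ {w | ∃ (k : ℕ) (v : Fin (k + 1) → L), k + 1 = d ∧ (∀ i, v i ∈ V) ∧
    w = coLieWord k v}

/-! ## Multiple polylogarithms, the depth filtration, and the depth conjecture -/

/-- The formal iterated integral
`I(x; w₁, …, wₙ; y) = Cor(w₁, …, wₙ, y) - Cor(x, w₁, …, wₙ)`. -/
def iterInt {F : Type u} [Field F] (x : F) (w : List F) (y : F) : Polylog F :=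
  cor (w ++ [y]) - cor (x :: w)

/-- The formal multiple polylogarithm
`Li_{n₀; n₁, …, n_d}(a₁, …, a_d) = (-1)^d I(0; 0^{n₀}, 1, 0^{n₁ - 1}, a₁, 0^{n₂ - 1}, a₁ a₂, …,
  a₁ ⋯ a_{d-1}, 0^{n_d - 1}; a₁ ⋯ a_d)`, where `0^k` stands for `k` zeros and `n₁, …, n_d ≥ 1`. -/
def Li {F : Type u} [Field F] {d : ℕ} (n₀ : ℕ) (n : Fin d → ℕ) (a : Fin d → Fˣ) : Polylog F :=
  (-1 : ℚ) ^ d • iterInt 0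
    (List.replicate n₀ 0 ++
      (List.ofFn fun i : Fin d =>
        (∏ j ∈ Finset.Iio i, (a j : F)) :: List.replicate (n i - 1) 0).flatten)
    (∏ j, (a j : F))

/-- `𝒟_d ℒ_n(F)`: the span of the multiple polylogarithms of weight `n` and depth at most `d`. -/
def depthPart (F : Type u) [Field F] (d n : ℕ) : Submodule ℚ (Polylog F) :=
  Submodule.span ℚ {x | ∃ (e n₀ : ℕ) (k : Fin e → ℕ) (a : Fin e → Fˣ),
    1 ≤ e ∧ e ≤ d ∧ (∀ i, 1 ≤ k i) ∧ n₀ + ∑ i, k i = n ∧ x = Li n₀ k a}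

/-- `𝒟_d ℒ_•(F)`. -/
def depthAll (F : Type u) [Field F] (d : ℕ) : Submodule ℚ (Polylog F) :=
  ⨆ n, depthPart F d n

/-- `𝒟_d ℒ_{≥ 2}(F)`. -/
def depthGeTwo (F : Type u) [Field F] (d : ℕ) : Submodule ℚ (Polylog F) :=
  ⨆ n, ⨆ _ : 2 ≤ n, depthPart F d n

/-- `ℬ_n(F)`: the span of the classical polylogarithms `Li_n(a) = Li_{0; n}(a)`. -/
def classicalPart (F : Type u) [Field F] (n : ℕ) : Submodule ℚ (Polylog F) :=
  Submodule.span ℚ {x | ∃ a : Fˣ, x = Li 0 (fun _ : Fin 1 => n) (fun _ => a)}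

/-- `⨁_{n ≥ 2} ℬ_n(F)`. -/
def classicalGeTwo (F : Type u) [Field F] : Submodule ℚ (Polylog F) :=
  ⨆ n, ⨆ _ : 2 ≤ n, classicalPart F n

/-- Goncharov's depth conjecture for the field `F`: a combination of multiple polylogarithms has
depth at most `d` if and only if `Δ̄^[d]` vanishes on it, and for `d ≥ 1` the map `Δ̄^[d - 1]`
induces an isomorphism `gr^𝒟_d ℒ_{≥ 2}(F) → coLie_d(⨁_{n ≥ 2} ℬ_n(F))`. -/
def DepthConjecture (F : Type u) [Field F] : Prop :=
  (∀ (d : ℕ) (x : Polylog F), x ∈ depthAll F d ↔ iterCobracket F d x = 0) ∧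
  ∀ d : ℕ, 1 ≤ d →
    ∃ φ : (depthGeTwo F d ⧸ (depthGeTwo F (d - 1)).submoduleOf (depthGeTwo F d)) ≃ₗ[ℚ]
        coLie d (classicalGeTwo F),
      ∀ x : depthGeTwo F d,
        (φ (Submodule.Quotient.mk x) : TensorAlgebra ℚ (Polylog F)) = iterCobracket F (d - 1) x

/-- A quadratically closed field: its characteristic is not two, and every element is a square. -/
def IsQuadraticallyClosed (F : Type u) [Field F] : Prop :=
  (2 : F) ≠ 0 ∧ ∀ x : F, IsSquare x

/-- The elements `Li_{n - d; 1, …, 1}(a₁, …, a_d)` (with `d` ones), for `1 ≤ d ≤ n`. -/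
def LiOnes {F : Type u} [Field F] (n d : ℕ) (a : Fin d → Fˣ) : Polylog F :=
  Li (n - d) (fun _ => 1) a

/-- The elements `Li_{0; n - d + 1, 1, …, 1}(a₁, …, a_d)` (with `d - 1` ones), for `1 ≤ d ≤ n`,
which correspond to the function `Li_{n - d + 1, 1, …, 1}`. -/
def LiHook {F : Type u} [Field F] (n d : ℕ) (a : Fin d → Fˣ) : Polylog F :=
  Li 0 (fun i => if (i : ℕ) = 0 then n - d + 1 else 1) a

end

end FormalPolylog

open FormalPolylog

/-!
# Multiple polylogarithms over a quadratically closed field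

All three statements follow from one fact: in weight `n ≥ 2`, the space `𝒟_d ℒ_n` is spanned,
modulo `𝒟_{d-1} ℒ_n`, by the correlators `Cor(x₀, …, x_d, 0^{n-d})` with `xᵢ ≠ 0`
(`depthPart_succ_le`). By cyclic symmetry and scaling such a correlator is, up to sign and modulo
smaller depth, both an element `Li_{n-d; 1, …, 1}` and an element `Li_{0; n-d+1, 1, …, 1}`
(`cor_tailWord_mem_ones`, `cor_tailWord_mem_hook`), and an induction on the depth concludes.

By the depth conjecture, an element of depth `d` is determined modulo smaller depth by its image
under `Δ̄^[d-1]`, which lies in `coLie_d(⨁_{n ≥ 2} ℬ_n)`. It therefore suffices that the images of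
the correlators above span this space. Since `Δ̄^[k]` vanishes in depth at most `k`, only the cuts into
parts of depths `d - 1` and `1` contribute to the iterated cobracket, and one finds
(`iterCor_tailWord`), with `yᵢ = xᵢ₋₁ / xᵢ`,
`Δ̄^[d-1] Cor(x₀, …, x_d, 0^{n-d}) = ± ∑ Li_{n₁}(y₁) ⋯ Li_{n_d}(y_d)`,
a sum of words of the cofree Lie coalgebra over all `nᵢ ≥ 2` with `n₁ + ⋯ + n_d = n`.

The individual words are recovered from these sums by means of the distribution relation
`Li_n(z²) = 2^{n-1} (Li_n(z) + Li_n(-z))`: every `y` is a square, and summing over the two square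
roots of `yᵢ` multiplies a word by `2^{1-nᵢ}`, so that the words with different exponents belong to
different eigenvalues (`eq_zero_of_sum_eq_zero`). The distribution relation itself is an instance of
specialization from `t = z` to `t = 0`, because `Δ Li_n(y) = Li_{n-1}(y) ∧ log y` reduces it to
smaller weight (`distribution_mem`).

In the formal setting, every elementary functional equation can be used only after its cobracket has
been shown to vanish modulo the equations of smaller weight. This is done for cyclic symmetry, for
scaling (`gen_scale_sub_mem`), and for the shuffle relations between words of zeros, which show that
correlators of weight at least two with at most one nonzero entry vanish.
-/

namespace FormalPolylog

noncomputable section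

/-! ### Cyclic sums and wedge products -/

theorem sum_rotate_succ {α M : Type*} [AddCommGroup M] (f : List α → M) (l : List α) :
    ∑ j ∈ Finset.range l.length, f (l.rotate (j + 1)) =
      ∑ j ∈ Finset.range l.length, f (l.rotate j) := by
  have h := (Finset.sum_range_succ' (fun j => f (l.rotate j)) l.length).symm.trans
    (Finset.sum_range_succ (fun j => f (l.rotate j)) l.length)
  simpa using h

section Wedge

variable {V : Type u} [AddCommGroup V] [Module ℚ V]

theorem wedge_self (x : V) : wedge x x = 0 := sub_self _

theorem wedge_zero_left (x : V) : wedge 0 x = 0 := by simp [wedge]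

theorem wedge_zero_right (x : V) : wedge x 0 = 0 := by simp [wedge]

theorem wedge_add_wedge_swap (x y : V) : wedge x y + wedge y x = 0 := by simp [wedge]

theorem wedge_add_left (x y z : V) : wedge (x + y) z = wedge x z + wedge y z := by
  simp only [wedge, TensorProduct.add_tmul, TensorProduct.tmul_add]; abel

theorem wedge_add_right (x y z : V) : wedge x (y + z) = wedge x y + wedge x z := by
  simp only [wedge, TensorProduct.add_tmul, TensorProduct.tmul_add]; abel

theorem wedge_sub_left (x y z : V) : wedge (x - y) z = wedge x z - wedge y z := by
  simp only [wedge, TensorProduct.sub_tmul, TensorProduct.tmul_sub]; abel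

theorem wedge_smul_left (c : ℚ) (x y : V) : wedge (c • x) y = c • wedge x y := by
  simp only [wedge, TensorProduct.smul_tmul', TensorProduct.tmul_smul, smul_sub]

theorem wedge_smul_right (c : ℚ) (x y : V) : wedge x (c • y) = c • wedge x y := by
  simp only [wedge, TensorProduct.smul_tmul', TensorProduct.tmul_smul, smul_sub]

theorem sum_wedge_reflect (f : ℕ → V) (n : ℕ) :
    ∑ i ∈ Finset.Ico 1 n, wedge (f i) (f (n - i)) = 0 := by
  refine Finset.sum_involution (fun i _ => n - i) ?_ ?_ ?_ ?_
  · intro i hi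
    rw [Finset.mem_Ico] at hi
    rw [show n - (n - i) = i by omega]
    exact wedge_add_wedge_swap _ _
  · intro i _ hne heq
    rw [heq] at hne
    exact hne (wedge_self _)
  · intro i hi
    rw [Finset.mem_Ico] at hi ⊢
    omega
  · intro i hi
    rw [Finset.mem_Ico] at hi
    omega

/-- The cut of a word into two words sharing its head, evaluated through a map `q` on words. -/
def cutWith {F : Type u} (q : List F → V) (i : ℕ) : List F → V ⊗[ℚ] V
  | [] => 0
  | x :: xs => wedge (q (x :: xs.take i)) (q (x :: xs.drop i))

end Wedge

/-- The class of the symbol `Cor(l)` modulo a space of relations. -/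
def corMod {F : Type u} (R : Submodule ℚ (Symb F)) (l : List F) : Symb F ⧸ R := R.mkQ (gen l)

theorem corMod_eq_zero {F : Type u} {R : Submodule ℚ (Symb F)} {l : List F} (h : gen l ∈ R) :
    corMod R l = 0 := (Submodule.Quotient.mk_eq_zero R).2 h

theorem corMod_eq {F : Type u} {R : Submodule ℚ (Symb F)} {l l' : List F}
    (h : gen l - gen l' ∈ R) : corMod R l = corMod R l' := (Submodule.Quotient.eq R).2 h

theorem map_cut {F : Type u} (R : Submodule ℚ (Symb F)) (i : ℕ) (l : List F) :
    TensorProduct.map R.mkQ R.mkQ (cut i l) = cutWith (corMod R) i l := by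
  cases l with
  | nil => simp [cut, cutWith]
  | cons x xs => simp [cut, cutWith, wedge, corMod]

theorem cobracketMod_gen {F : Type u} (R : Submodule ℚ (Symb F)) (l : List F) :
    cobracketMod R (gen l) = ∑ j ∈ Finset.range l.length, ∑ i ∈ Finset.Ico 1 (l.length - 1),
      cutWith (corMod R) i (l.rotate j) := by
  rw [cobracketMod, LinearMap.comp_apply, symbCobracket_gen, cobracketGen, map_sum]
  simp only [map_sum, map_cut]

theorem cobracketGen_rotate {F : Type u} (l : List F) :
    cobracketGen (l.rotate 1) = cobracketGen l := by
  unfold cobracketGen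
  rw [List.length_rotate]
  simp only [List.rotate_rotate, Nat.add_comm 1]
  exact sum_rotate_succ (fun w => ∑ i ∈ Finset.Ico 1 (l.length - 1), cut i w) l

theorem gen_mem_homog {F : Type u} {n : ℕ} {l : List F} (h : l.length = n + 1) :
    gen l ∈ homog F n :=
  Finsupp.single_mem_supported ℚ _ h

/-- The defect of scaling invariance: `log c` in weight one, off the diagonal. -/
def scaleDefect {F V : Type u} [AddCommGroup V] (L : V) : List F → V
  | [x, y] => open Classical in if x = y then 0 else L
  | _ => 0

theorem scaleDefect_of_length_ne {F V : Type u} [AddCommGroup V] (L : V) {l : List F}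
    (h : l.length ≠ 2) : scaleDefect L l = 0 := by
  match l with
  | [] => rfl
  | [_] => rfl
  | [_, _] => exact absurd rfl h
  | _ :: _ :: _ :: _ => rfl

theorem wedge_scaleDefect {F V : Type u} [AddCommGroup V] [Module ℚ V] (L : V) (l l' : List F) :
    wedge (scaleDefect L l) (scaleDefect L l') = 0 := by
  have hs : ∀ l : List F, scaleDefect L l = 0 ∨ scaleDefect L l = L := by
    intro l
    by_cases hl : l.length = 2
    · obtain ⟨x, y, rfl⟩ := List.length_eq_two.1 hl
      simp only [scaleDefect]
      split_ifs <;> simp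
    · exact .inl (scaleDefect_of_length_ne L hl)
  rcases hs l with h | h <;> rcases hs l' with h' | h' <;>
    simp [h, h', wedge_self, wedge_zero_left, wedge_zero_right]

/-! ### Relations between logarithms -/

section Relations

variable {F : Type u} [Field F]

theorem rel_mono : Monotone fun n => rel n F :=
  monotone_nat_of_le_succ fun n => by
    rw [rel]
    exact le_sup_left

theorem mem_rel_succ {n : ℕ} {r : Symb F} (h : r ∈ homog F (n + 2))
    (he : ElementaryRelation r ∨ SpecializationRelation (n + 2) (rel n (RatFunc F)) r)
    (hd : cobracketMod (rel n F) r = 0) : r ∈ rel (n + 1) F := by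
  rw [rel]
  exact Submodule.mem_sup_right (Submodule.subset_span ⟨h, he, hd⟩)

variable {R : Submodule ℚ (Symb F)}

theorem logRelation_mem (hR : rel 0 F ≤ R) {r : Symb F} (h : LogRelation r) : r ∈ R :=
  hR (by rw [rel]; exact Submodule.subset_span h)

theorem corMod_diag (hR : rel 0 F ≤ R) (x : F) : corMod R [x, x] = 0 :=
  corMod_eq_zero (logRelation_mem hR (.diag x))

theorem corMod_pair (hR : rel 0 F ≤ R) (x y : F) : corMod R [x, y] = corMod R [0, y - x] :=
  corMod_eq (logRelation_mem hR (.transl x y))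

theorem corMod_log_mul (hR : rel 0 F ≤ R) {a b : F} (ha : a ≠ 0) (hb : b ≠ 0) :
    corMod R [0, a * b] = corMod R [0, a] + corMod R [0, b] := by
  have h := (Submodule.Quotient.mk_eq_zero R).2 (logRelation_mem hR (.mul a b ha hb))
  have h' : corMod R [0, a * b] - corMod R [0, a] - corMod R [0, b] = 0 := h
  rw [sub_sub] at h'
  exact sub_eq_zero.1 h'

theorem corMod_log_one (hR : rel 0 F ≤ R) : corMod R [(0 : F), 1] = 0 := by
  have h := corMod_log_mul hR (one_ne_zero (α := F)) one_ne_zero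
  rw [one_mul] at h
  exact left_eq_add.1 h

theorem corMod_log_sq (hR : rel 0 F ≤ R) {a : F} (ha : a ≠ 0) :
    corMod R [0, a ^ 2] = (2 : ℚ) • corMod R [0, a] := by
  rw [pow_two, corMod_log_mul hR ha ha, two_smul]

theorem corMod_log_neg (hR : rel 0 F ≤ R) (a : F) :
    corMod R [0, -a] = corMod R [0, a] := by
  by_cases ha : a = 0
  · rw [ha, neg_zero]
  have h := corMod_log_sq hR (neg_ne_zero.2 ha)
  rw [neg_sq, corMod_log_sq hR ha] at h
  exact (smul_right_injective _ (two_ne_zero (α := ℚ)) h).symm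

theorem corMod_pair_swap (hR : rel 0 F ≤ R) (x y : F) : corMod R [x, y] = corMod R [y, x] := by
  rw [corMod_pair hR, ← corMod_log_neg hR, neg_sub, ← corMod_pair hR]

theorem corMod_scale_pair (hR : rel 0 F ≤ R) {c : F} (hc : c ≠ 0) (x y : F) :
    corMod R [c * x, c * y] = corMod R [x, y] + scaleDefect (corMod R [0, c]) [x, y] := by
  simp only [scaleDefect]
  split_ifs with h
  · rw [h, corMod_diag hR, corMod_diag hR, add_zero]
  · rw [corMod_pair hR, corMod_pair hR x y, ← mul_sub,
      corMod_log_mul hR hc (sub_ne_zero.2 (Ne.symm h)), add_comm]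

/-! ### Cyclic symmetry and scaling -/

theorem gen_rotate_sub_mem (n : ℕ) {l : List F} (hl : l.length = n + 3) :
    gen (l.rotate 1) - gen l ∈ rel (n + 1) F := by
  refine mem_rel_succ ?_ (.inl (.cyclic l)) ?_
  · exact sub_mem (gen_mem_homog (by simpa using hl)) (gen_mem_homog hl)
  · rw [cobracketMod, LinearMap.comp_apply, map_sub, symbCobracket_gen, symbCobracket_gen,
      cobracketGen_rotate, sub_self, map_zero]

/-- Correlators are cyclically symmetric modulo the relations of their weight. -/
theorem corMod_rotate_one {n : ℕ} (hR : rel n F ≤ R) {l : List F} (hl : l.length = n + 2) :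
    corMod R (l.rotate 1) = corMod R l := by
  match n with
  | 0 =>
    obtain ⟨x, y, rfl⟩ := List.length_eq_two.1 hl
    exact corMod_pair_swap hR y x
  | n + 1 => exact corMod_eq (hR (gen_rotate_sub_mem n hl))

/-- Scaling changes only the factors of weight one of the cobracket, by multiples of `log c`; the
resulting terms `log c ∧ Cor(…)` telescope along the cyclic word. -/
theorem sum_cutWith_map {V : Type u} [AddCommGroup V] [Module ℚ V] (q : List F → V) (L : V)
    (c : F) (n : ℕ)
    (hscale : ∀ w : List F, 2 ≤ w.length → w.length ≤ n + 2 →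
      q (w.map (c * ·)) = q w + scaleDefect L w)
    (hcyc : ∀ w : List F, w.length = n + 2 → q (w.rotate 1) = q w)
    (l : List F) (hl : l.length = n + 3) :
    ∑ j ∈ Finset.range l.length, ∑ i ∈ Finset.Ico 1 (n + 2),
        cutWith q i ((l.map (c * ·)).rotate j) =
      ∑ j ∈ Finset.range l.length, ∑ i ∈ Finset.Ico 1 (n + 2), cutWith q i (l.rotate j) := by
  -- `A w` and `B w` are the defects of the first and of the last cut at the head of `w`
  let A : List F → V ⊗[ℚ] V := fun w => wedge (scaleDefect L (w.take 2)) (q (w.eraseIdx 1))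
  let B : List F → V ⊗[ℚ] V := fun w =>
    wedge (q (w.take (n + 2))) (scaleDefect L (w.take 1 ++ w.drop (n + 2)))
  have hsplit : ∀ w : List F, w.length = n + 3 →
      ∑ i ∈ Finset.Ico 1 (n + 2), cutWith q i (w.map (c * ·)) =
        ∑ i ∈ Finset.Ico 1 (n + 2), cutWith q i w + (A w + B w) := by
    intro w hw
    obtain ⟨a, b, t, rfl⟩ : ∃ a b t, w = a :: b :: t := by
      match w, hw with
      | a :: b :: t, _ => exact ⟨a, b, t, rfl⟩
    have ht : t.length = n + 1 := by simpa using hw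
    have hterm : ∀ i ∈ Finset.Ico 1 (n + 2), cutWith q i ((a :: b :: t).map (c * ·)) =
        cutWith q i (a :: b :: t) +
        (wedge (scaleDefect L (a :: (b :: t).take i)) (q (a :: (b :: t).drop i)) +
          wedge (q (a :: (b :: t).take i)) (scaleDefect L (a :: (b :: t).drop i))) := by
      intro i hi
      rw [Finset.mem_Ico] at hi
      have h1 := hscale (a :: (b :: t).take i) (by simp [ht]; omega) (by simp [ht]; omega)
      have h2 := hscale (a :: (b :: t).drop i) (by simp [ht]; omega) (by simp [ht]; omega)
      rw [List.map_cons, List.map_take] at h1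
      rw [List.map_cons, List.map_drop] at h2
      rw [List.map_cons, cutWith, cutWith, h1, h2]
      simp only [wedge_add_left, wedge_add_right, wedge_scaleDefect]
      abel
    rw [Finset.sum_congr rfl hterm, Finset.sum_add_distrib, Finset.sum_add_distrib]
    congr 2
    · rw [Finset.sum_eq_single 1]
      · simp [A]
      · intro i hi hi1
        rw [Finset.mem_Ico] at hi
        rw [scaleDefect_of_length_ne, wedge_zero_left]
        simp [ht]; omega
      · intro h; simp at h
    · rw [Finset.sum_eq_single (n + 1)]
      · simp [B]
      · intro i hi hi1
        rw [Finset.mem_Ico] at hi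
        rw [scaleDefect_of_length_ne L (l := a :: (b :: t).drop i), wedge_zero_right]
        simp [ht]; omega
      · intro h; simp at h
  -- the last cut at the next letter involves the same pair of letters as the first cut at the head
  have hAB : ∀ w : List F, w.length = n + 3 →
      A w + B (w.rotate 1) = wedge L (q (w.rotate 1).tail) - wedge L (q w.tail) := by
    intro w hw
    obtain ⟨a, b, t, rfl⟩ : ∃ a b t, w = a :: b :: t := by
      match w, hw with
      | a :: b :: t, _ => exact ⟨a, b, t, rfl⟩
    have ht : t.length = n + 1 := by simpa using hw
    have hr : (a :: b :: t).rotate 1 = b :: (t ++ [a]) := by simp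
    have hq : q (t ++ [a]) = q (a :: t) := by
      rw [← hcyc (a :: t) (by simp [ht])]; simp
    have h2 : (b :: (t ++ [a])).take (n + 2) = b :: t := by
      rw [List.take_succ_cons, List.take_append_of_le_length (by omega),
        List.take_of_length_le (by omega)]
    have h3 : (b :: (t ++ [a])).drop (n + 2) = [a] := by
      rw [List.drop_succ_cons, ← ht, List.drop_left]
    simp only [A, B, hr, h2, h3, List.tail_cons, hq]
    simp only [List.take_succ_cons, List.take_zero, List.eraseIdx_cons_succ,
      List.eraseIdx_cons_zero, List.cons_append, List.nil_append, scaleDefect]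
    by_cases hab : a = b
    · subst hab; simp [wedge_zero_left, wedge_zero_right]
    · rw [if_neg hab, if_neg (Ne.symm hab),
        eq_neg_of_add_eq_zero_left (wedge_add_wedge_swap (q (b :: t)) L)]
      abel
  have hrot : ∀ j, (l.rotate j).length = n + 3 := fun j => by simpa using hl
  have h1 : ∀ j ∈ Finset.range l.length, ∑ i ∈ Finset.Ico 1 (n + 2),
      cutWith q i ((l.map (c * ·)).rotate j) =
      ∑ i ∈ Finset.Ico 1 (n + 2), cutWith q i (l.rotate j) + (A (l.rotate j) + B (l.rotate j)) :=
    fun j _ => by rw [← List.map_rotate, hsplit _ (hrot j)]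
  rw [Finset.sum_congr rfl h1, Finset.sum_add_distrib, Finset.sum_add_distrib,
    ← sum_rotate_succ B, ← Finset.sum_add_distrib]
  have h2 : ∀ j ∈ Finset.range l.length, A (l.rotate j) + B (l.rotate (j + 1)) =
      wedge L (q (l.rotate (j + 1)).tail) - wedge L (q (l.rotate j).tail) := fun j _ => by
    rw [← List.rotate_rotate, hAB _ (hrot j)]
  rw [Finset.sum_congr rfl h2, Finset.sum_sub_distrib,
    sum_rotate_succ (fun w => wedge L (q w.tail)), sub_self, add_zero]

theorem gen_scale_sub_mem {c : F} (hc : c ≠ 0) (n : ℕ) :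
    ∀ l : List F, l.length = n + 3 → gen (l.map (c * ·)) - gen l ∈ rel (n + 1) F := by
  induction n using Nat.strong_induction_on with
  | _ n ih =>
    intro l hl
    refine mem_rel_succ ?_ (.inl (.scale c hc l)) ?_
    · exact sub_mem (gen_mem_homog (by simpa using hl)) (gen_mem_homog hl)
    have h0 : rel 0 F ≤ rel n F := rel_mono (Nat.zero_le n)
    rw [map_sub, cobracketMod_gen, cobracketMod_gen, List.length_map, sub_eq_zero,
      show l.length - 1 = n + 2 by omega]
    refine sum_cutWith_map (corMod (rel n F)) (corMod (rel n F) [0, c]) c n ?_ ?_ l hl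
    · intro w hw2 hwn
      by_cases hw : w.length = 2
      · obtain ⟨x, y, rfl⟩ := List.length_eq_two.1 hw
        exact corMod_scale_pair h0 hc x y
      · obtain ⟨k, hk⟩ : ∃ k, w.length = k + 3 := ⟨w.length - 3, by omega⟩
        rw [scaleDefect_of_length_ne _ hw, add_zero]
        exact corMod_eq (rel_mono (by omega : k + 1 ≤ n) (ih k (by omega) w hk))
    · intro w hw
      exact corMod_rotate_one le_rfl hw

/-! ### Vanishing of correlators with one nonzero entry -/

theorem shuffles_singleton_replicate {α : Type u} (a : α) (n : ℕ) :
    shuffles [a] (List.replicate n a) = List.replicate (n + 1) (List.replicate (n + 1) a) := by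
  induction n with
  | zero => simp [shuffles]
  | succ n ih =>
    rw [List.replicate_succ, shuffles, ih, shuffles]
    simp [List.replicate_succ]

/-- By the shuffle relation between `0` and a word of zeros. -/
theorem gen_cons_replicate_mem (n : ℕ) :
    ∀ x : F, gen (x :: List.replicate (n + 2) 0) ∈ rel (n + 1) F := by
  induction n using Nat.strong_induction_on with
  | _ n ih =>
    intro x
    have hzero : ∀ p, 1 ≤ p → p ≤ n + 1 →
        corMod (rel n F) ((0 : F) :: List.replicate p 0) = 0 := by
      intro p hp1 hpn
      by_cases hp : p = 1
      · subst hp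
        exact corMod_diag (rel_mono (Nat.zero_le n)) 0
      · obtain ⟨k, rfl⟩ : ∃ k, p = k + 2 := ⟨p - 2, by omega⟩
        exact corMod_eq_zero (rel_mono (by omega : k + 1 ≤ n) (ih k (by omega) 0))
    have hd : cobracketMod (rel n F) (gen (x :: List.replicate (n + 2) 0)) = 0 := by
      rw [cobracketMod_gen]
      simp only [List.length_cons, List.length_replicate]
      rw [Finset.sum_range_succ', List.rotate_zero]
      have hhead : ∑ i ∈ Finset.Ico 1 (n + 2 + 1 - 1),
          cutWith (corMod (rel n F)) i (x :: List.replicate (n + 2) 0) = 0 := by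
        refine Eq.trans ?_ (sum_wedge_reflect
          (fun i => corMod (rel n F) (x :: List.replicate i 0)) (n + 2))
        refine Finset.sum_congr rfl fun i hi => ?_
        rw [Finset.mem_Ico] at hi
        simp only [cutWith, List.take_replicate, List.drop_replicate]
        rw [min_eq_left (by omega)]
      rw [hhead, add_zero]
      refine Finset.sum_eq_zero fun j hj => Finset.sum_eq_zero fun i hi => ?_
      rw [Finset.mem_range] at hj
      rw [Finset.mem_Ico] at hi
      obtain ⟨s, hs⟩ : ∃ s, n + 2 = s + 1 + j := ⟨n + 1 - j, by omega⟩
      have hrot : (x :: List.replicate (n + 2) (0 : F)).rotate (j + 1) =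
          0 :: (List.replicate s 0 ++ x :: List.replicate j 0) := by
        rw [List.rotate_eq_drop_append_take (by simp; omega), List.drop_succ_cons,
          List.take_succ_cons, List.drop_replicate, List.take_replicate, min_eq_left (by omega),
          show n + 2 - j = s + 1 by omega, List.replicate_succ, List.cons_append]
      rw [hrot, cutWith]
      by_cases his : i ≤ s
      · rw [List.take_append_of_le_length (by simpa using his), List.take_replicate,
          min_eq_left his, hzero i (by omega) (by omega), wedge_zero_left]
      · obtain ⟨k, rfl⟩ : ∃ k, i = s + (k + 1) := ⟨i - s - 1, by omega⟩
        have : (List.replicate s (0 : F) ++ x :: List.replicate j 0).drop (s + (k + 1)) =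
            List.replicate (j - k) 0 := by
          simp [List.drop_append]
        rw [this, hzero (j - k) (by omega) (by omega), wedge_zero_right]
    have hmem : ((shuffles [(0 : F)] (List.replicate (n + 1) 0)).map
        fun w => gen (x :: w)).sum ∈ rel (n + 1) F := by
      have hsum : ((shuffles [(0 : F)] (List.replicate (n + 1) 0)).map
          fun w => gen (x :: w)).sum = (n + 2) • gen (x :: List.replicate (n + 2) 0) := by
        rw [shuffles_singleton_replicate, List.map_replicate, List.sum_replicate]
      refine mem_rel_succ ?_ (.inl (.shuffle x _ _ (by simp) (by simp))) ?_
      · rw [hsum]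
        exact nsmul_mem (gen_mem_homog (by simp)) _
      · rw [hsum, map_nsmul, hd, smul_zero]
    rw [shuffles_singleton_replicate, List.map_replicate, List.sum_replicate,
      ← Nat.cast_smul_eq_nsmul ℚ] at hmem
    exact (Submodule.smul_mem_iff _ (by positivity)).1 hmem

end Relations

/-! ### The distribution relation for classical polylogarithms -/

section Classical

variable {F : Type u} [Field F]

/-- The word `(1, 0^r, y)`, whose correlator is `-Li_{r+1}(y)` in weight at least two. -/
def classicalWord (r : ℕ) (y : F) : List F := 1 :: (List.replicate r 0 ++ [y])

@[simp] theorem length_classicalWord (r : ℕ) (y : F) : (classicalWord r y).length = r + 2 := by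
  simp [classicalWord]

theorem corMod_cons_replicate {n p : ℕ} (x : F) (hp : 2 ≤ p) (hpn : p ≤ n + 1) :
    corMod (rel n F) (x :: List.replicate p 0) = 0 := by
  obtain ⟨k, rfl⟩ : ∃ k, p = k + 2 := ⟨p - 2, by omega⟩
  exact corMod_eq_zero (rel_mono (by omega : k + 1 ≤ n) (gen_cons_replicate_mem k x))

theorem corMod_zero_cons_replicate {n p : ℕ} (hp : 1 ≤ p) (hpn : p ≤ n + 1) :
    corMod (rel n F) (0 :: List.replicate p 0) = 0 := by
  by_cases h : p = 1
  · subst h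
    exact corMod_diag (rel_mono (Nat.zero_le n)) 0
  · exact corMod_cons_replicate 0 (by omega) hpn

theorem corMod_one_cons_replicate {n p : ℕ} (hp : 1 ≤ p) (hpn : p ≤ n + 1) :
    corMod (rel n F) (1 :: List.replicate p 0) = 0 := by
  by_cases h : p = 1
  · subst h
    have h0 : rel 0 F ≤ rel n F := rel_mono (Nat.zero_le n)
    exact (corMod_pair_swap h0 1 0).trans (corMod_log_one h0)
  · exact corMod_cons_replicate 1 (by omega) hpn

theorem corMod_zero_one_cons_replicate {n p : ℕ} (hpn : p ≤ n) :
    corMod (rel n F) (0 :: 1 :: List.replicate p 0) = 0 := by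
  have h := corMod_rotate_one (rel_mono (by omega : p ≤ n))
    (l := (0 : F) :: 1 :: List.replicate p 0) (by simp)
  rw [← h, List.rotate_cons_succ, List.rotate_zero, List.cons_append, ← List.replicate_succ',
    corMod_one_cons_replicate (by omega) (by omega)]

/-- `Δ Li_{n+2}(y) = Li_{n+1}(y) ∧ log y`. -/
theorem cobracketMod_classicalWord (n : ℕ) (y : F) :
    cobracketMod (rel n F) (gen (classicalWord (n + 1) y)) =
      wedge (corMod (rel n F) (classicalWord n y)) (corMod (rel n F) [0, y]) := by
  have h0 : rel 0 F ≤ rel n F := rel_mono (Nat.zero_le n)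
  rw [cobracketMod_gen, length_classicalWord, Finset.sum_range_succ, Finset.sum_range_succ',
    List.rotate_zero, show n + 1 + 2 - 1 = n + 2 by omega]
  have hone : ∑ i ∈ Finset.Ico 1 (n + 2),
      cutWith (corMod (rel n F)) i (classicalWord (n + 1) y) = 0 := by
    refine Finset.sum_eq_zero fun i hi => ?_
    rw [Finset.mem_Ico] at hi
    rw [classicalWord, cutWith, List.take_append_of_le_length (by simp; omega), List.take_replicate,
      min_eq_left (by omega), corMod_one_cons_replicate (by omega) (by omega), wedge_zero_left]
  have hmid : ∑ j ∈ Finset.range (n + 1), ∑ i ∈ Finset.Ico 1 (n + 2),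
      cutWith (corMod (rel n F)) i ((classicalWord (n + 1) y).rotate (j + 1)) = 0 := by
    refine Finset.sum_eq_zero fun j hj => Finset.sum_eq_zero fun i hi => ?_
    rw [Finset.mem_range] at hj
    rw [Finset.mem_Ico] at hi
    obtain ⟨s, rfl⟩ : ∃ s, n = s + j := ⟨n - j, by omega⟩
    have hrot : (classicalWord (s + j + 1) y).rotate (j + 1) =
        0 :: (List.replicate s 0 ++ y :: 1 :: List.replicate j 0) := by
      rw [classicalWord, List.rotate_eq_drop_append_take (by simp; omega), List.drop_succ_cons,
        List.take_succ_cons, List.drop_append_of_le_length (by simp; omega),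
        List.take_append_of_le_length (by simp; omega), List.drop_replicate, List.take_replicate,
        min_eq_left (by omega), show s + j + 1 - j = s + 1 by omega, List.replicate_succ]
      simp
    rw [hrot, cutWith]
    rcases lt_trichotomy i (s + 1) with his | his | his
    · rw [List.take_append_of_le_length (by simp; omega), List.take_replicate,
        min_eq_left (by omega), corMod_zero_cons_replicate (by omega) (by omega), wedge_zero_left]
    · have hdrop : (List.replicate s (0 : F) ++ y :: 1 :: List.replicate j 0).drop i =
          1 :: List.replicate j 0 := by
        subst his
        simp [List.drop_append]
      rw [hdrop, corMod_zero_one_cons_replicate (by omega), wedge_zero_right]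
    · obtain ⟨k, rfl⟩ : ∃ k, i = s + (k + 1 + 1) := ⟨i - s - 2, by omega⟩
      have hdrop : (List.replicate s (0 : F) ++ y :: 1 :: List.replicate j 0).drop
          (s + (k + 1 + 1)) = List.replicate (j - k) 0 := by
        simp [List.drop_append]
      rw [hdrop, corMod_zero_cons_replicate (by omega) (by omega), wedge_zero_right]
  have hlast : (classicalWord (n + 1) y).rotate (n + 2) = y :: 1 :: List.replicate (n + 1) 0 := by
    have h := List.rotate_append_length_eq (1 :: List.replicate (n + 1) (0 : F)) [y]
    simpa [classicalWord] using h
  rw [hone, hmid, hlast, zero_add, zero_add, Finset.sum_eq_single (n + 1)]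
  · have hc := corMod_rotate_one (le_refl (rel n F)) (l := y :: 1 :: List.replicate n 0) (by simp)
    simp only [cutWith, List.take_succ_cons, List.drop_succ_cons, List.take_replicate,
      List.drop_replicate, min_eq_left (Nat.le_succ n), Nat.add_sub_cancel_left,
      List.replicate_one]
    rw [← hc, corMod_pair_swap h0 y 0]
    simp [classicalWord]
  · intro i hi hne
    rw [Finset.mem_Ico] at hi
    obtain ⟨k, rfl⟩ : ∃ k, i = k + 1 := ⟨i - 1, by omega⟩
    rw [cutWith, List.drop_succ_cons, List.drop_replicate,
      corMod_cons_replicate y (by omega) (by omega), wedge_zero_right]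
  · intro h
    simp at h

/-- The defect of the distribution relation `Li_{r+1}(z²) = 2^r (Li_{r+1}(z) + Li_{r+1}(-z))`. -/
def distribution (r : ℕ) (z : F) : Symb F :=
  gen (classicalWord r (z ^ 2)) -
    (2 : ℚ) ^ r • (gen (classicalWord r z) + gen (classicalWord r (-z)))

theorem distribution_mem_homog (r : ℕ) (z : F) : distribution r z ∈ homog F (r + 1) :=
  sub_mem (gen_mem_homog (by simp)) (Submodule.smul_mem _ _
    (add_mem (gen_mem_homog (by simp)) (gen_mem_homog (by simp))))

theorem mkQ_distribution (R : Submodule ℚ (Symb F)) (r : ℕ) (z : F) :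
    R.mkQ (distribution r z) = corMod R (classicalWord r (z ^ 2)) -
      (2 : ℚ) ^ r • (corMod R (classicalWord r z) + corMod R (classicalWord r (-z))) := by
  rw [distribution, map_sub, map_smul, map_add]
  rfl

theorem cobracketMod_distribution (n : ℕ) {z : F} (hz : z ≠ 0) :
    cobracketMod (rel n F) (distribution (n + 1) z) =
      (2 : ℚ) • wedge ((rel n F).mkQ (distribution n z)) (corMod (rel n F) [0, z]) := by
  have h0 : rel 0 F ≤ rel n F := rel_mono (Nat.zero_le n)
  rw [mkQ_distribution, distribution, map_sub, map_smul, map_add, cobracketMod_classicalWord,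
    cobracketMod_classicalWord, cobracketMod_classicalWord, corMod_log_sq h0 hz,
    corMod_log_neg h0, wedge_sub_left, wedge_smul_left, wedge_add_left, wedge_smul_right,
    pow_succ' (2 : ℚ) n, mul_smul, smul_sub]

/-- In weight one: `log (1 - z²) = log (1 - z) + log (1 + z)`, where `log z = 0` if `z = ±1`. -/
theorem wedge_distribution_zero (z : F) :
    wedge ((rel 0 F).mkQ (distribution 0 z)) (corMod (rel 0 F) [0, z]) = 0 := by
  have h0 : rel 0 F ≤ rel 0 F := le_rfl
  by_cases h1 : z = 1
  · rw [h1, corMod_log_one h0, wedge_zero_right]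
  by_cases h2 : z = -1
  · rw [h2, corMod_log_neg h0, corMod_log_one h0, wedge_zero_right]
  have h3 : (rel 0 F).mkQ (distribution 0 z) = 0 := by
    simp only [mkQ_distribution, classicalWord, List.replicate_zero, List.nil_append, pow_zero,
      one_smul]
    rw [corMod_pair h0, corMod_pair h0 1 z, corMod_pair h0 1 (-z),
      ← corMod_log_neg h0 (-z - 1), show z ^ 2 - 1 = (z - 1) * -(-z - 1) by ring,
      corMod_log_mul h0 (sub_ne_zero.2 h1), sub_self]
    rw [neg_ne_zero, sub_ne_zero]
    exact fun h => h2 (by rw [← h, neg_neg])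
  rw [h3, wedge_zero_left]

theorem specializes_classicalWord (a : F) (r : ℕ) (p : Polynomial F) :
    Specializes a (classicalWord (r + 1) (algebraMap (Polynomial F) (RatFunc F) p))
      ((classicalWord (r + 1) (algebraMap (Polynomial F) (RatFunc F) p)).map
        (RatFunc.eval (RingHom.id F) a)) := by
  refine ⟨⟨0, 1, one_ne_zero, ?_⟩, ?_⟩
  · rw [List.forall₂_map_right_iff, List.forall₂_same]
    intro g hg
    obtain ⟨s, rfl⟩ : ∃ s : Polynomial F, g = algebraMap (Polynomial F) (RatFunc F) s := by
      simp only [classicalWord, List.mem_cons, List.mem_append, List.mem_replicate,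
        List.not_mem_nil, or_false] at hg
      rcases hg with rfl | ⟨-, rfl⟩ | rfl
      · exact ⟨1, (map_one _).symm⟩
      · exact ⟨0, (map_zero _).symm⟩
      · exact ⟨p, rfl⟩
    rw [sub_zero, one_mul]
    exact ⟨by simp, rfl⟩
  · rintro ⟨y, hy⟩
    have h1 : (1 : F) = y := hy 1 (by simp [classicalWord, RatFunc.eval_one])
    have h2 : (0 : F) = y := hy 0 (by simp [classicalWord, RatFunc.eval_zero])
    exact absurd (h1.trans h2.symm) one_ne_zero

theorem map_eval_classicalWord (a : F) (r : ℕ) (p : Polynomial F) :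
    (classicalWord r (algebraMap (Polynomial F) (RatFunc F) p)).map
      (RatFunc.eval (RingHom.id F) a) = classicalWord r (p.eval a) := by
  simp [classicalWord, RatFunc.eval_one, RatFunc.eval_zero, RatFunc.eval_algebraMap,
    Polynomial.eval₂_id]

theorem mapDomain_gen {α β : Type u} (f : List α → List β) (l : List α) :
    Finsupp.mapDomain f (gen l) = gen (f l) := Finsupp.mapDomain_single

end Classical

theorem distribution_zero_mem (n : ℕ) (F : Type u) [Field F] :
    distribution (n + 1) (0 : F) ∈ rel (n + 1) F := by
  have h : gen (classicalWord (n + 1) (0 : F)) ∈ rel (n + 1) F := by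
    have h1 := gen_cons_replicate_mem n (1 : F)
    rwa [List.replicate_succ'] at h1
  rw [distribution, zero_pow two_ne_zero, neg_zero]
  exact sub_mem h (Submodule.smul_mem _ _ (add_mem h h))

theorem cobracketMod_distribution_zero (n : ℕ) (F : Type u) [Field F] :
    cobracketMod (rel n F) (distribution (n + 1) (0 : F)) = 0 := by
  have h : cobracketMod (rel n F) (gen (classicalWord (n + 1) (0 : F))) = 0 := by
    rw [cobracketMod_classicalWord, corMod_diag (rel_mono (Nat.zero_le n)), wedge_zero_right]
  rw [distribution, zero_pow two_ne_zero, neg_zero, map_sub, map_smul, map_add, h]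
  simp

/-- The distribution relation is the specialization relation for its defect over `F(t)` between
`t = z` and `t = 0`, where all terms vanish. -/
theorem distribution_mem_of_cobracketMod_eq_zero (n : ℕ)
    (h : ∀ (F : Type u) [Field F] (z : F), z ≠ 0 →
      cobracketMod (rel n F) (distribution (n + 1) z) = 0)
    (F : Type u) [Field F] {z : F} (hz : z ≠ 0) : distribution (n + 1) z ∈ rel (n + 1) F := by
  have hmap : ∀ a : F, Finsupp.mapDomain (List.map (RatFunc.eval (RingHom.id F) a))
      (distribution (n + 1) (RatFunc.X : RatFunc F)) = distribution (n + 1) a := by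
    intro a
    have h1 := map_eval_classicalWord a (n + 1) Polynomial.X
    have h2 := map_eval_classicalWord a (n + 1) (Polynomial.X ^ 2)
    have h3 := map_eval_classicalWord a (n + 1) (-Polynomial.X)
    simp only [map_pow, map_neg, RatFunc.algebraMap_X, Polynomial.eval_pow, Polynomial.eval_neg,
      Polynomial.eval_X] at h1 h2 h3
    rw [distribution, sub_eq_add_neg, ← neg_smul, Finsupp.mapDomain_add, Finsupp.mapDomain_smul,
      Finsupp.mapDomain_add, mapDomain_gen, mapDomain_gen, mapDomain_gen, h1, h2, h3, neg_smul,
      ← sub_eq_add_neg, distribution]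
  have hsupp : ∀ l ∈ (distribution (n + 1) (RatFunc.X : RatFunc F)).support,
      ∃ p : Polynomial F, l = classicalWord (n + 1) (algebraMap (Polynomial F) (RatFunc F) p) := by
    intro l hl
    by_contra hne
    push Not at hne
    have h1 := (hne Polynomial.X).symm
    have h2 := (hne (Polynomial.X ^ 2)).symm
    have h3 := (hne (-Polynomial.X)).symm
    simp only [map_pow, map_neg, RatFunc.algebraMap_X] at h1 h2 h3
    rw [Finsupp.mem_support_iff] at hl
    exact hl (by simp [distribution, gen, h1, h2, h3])
  have hspec : distribution (n + 1) z - distribution (n + 1) 0 ∈ rel (n + 1) F := by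
    refine mem_rel_succ (sub_mem (distribution_mem_homog _ _) (distribution_mem_homog _ _))
      (.inr ⟨distribution (n + 1) RatFunc.X, z, 0, List.map (RatFunc.eval (RingHom.id F) z),
        List.map (RatFunc.eval (RingHom.id F) 0), distribution_mem_homog _ _,
        h _ _ RatFunc.X_ne_zero, ?_, ?_⟩) ?_
    · intro l hl
      obtain ⟨p, rfl⟩ := hsupp l hl
      exact ⟨specializes_classicalWord z n p, specializes_classicalWord 0 n p⟩
    · rw [hmap, hmap]
    · rw [map_sub, h F z hz, cobracketMod_distribution_zero, sub_zero]
  simpa using add_mem hspec (distribution_zero_mem n F)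

theorem distribution_mem (n : ℕ) : ∀ (F : Type u) [Field F] (z : F), z ≠ 0 →
    distribution (n + 1) z ∈ rel (n + 1) F := by
  induction n with
  | zero =>
    refine fun F _ z hz => distribution_mem_of_cobracketMod_eq_zero 0 ?_ F hz
    intro F _ z hz
    rw [cobracketMod_distribution 0 hz, wedge_distribution_zero, smul_zero]
  | succ n ih =>
    refine fun F _ z hz => distribution_mem_of_cobracketMod_eq_zero (n + 1) ?_ F hz
    intro F _ z hz
    rw [cobracketMod_distribution (n + 1) hz,
      (LinearMap.mem_ker (f := (rel (n + 1) F).mkQ)).1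
        (by rw [Submodule.ker_mkQ]; exact ih F z hz), wedge_zero_left, smul_zero]

/-! ### Correlators in the Lie coalgebra -/

section Correlators

variable {F : Type u} [Field F]

theorem rel_le_allRel (n : ℕ) : rel n F ≤ allRel F := le_iSup (fun n => rel n F) n

theorem cor_eq_of_mem {n : ℕ} {l l' : List F} (h : gen l - gen l' ∈ rel n F) : cor l = cor l' :=
  corMod_eq (rel_le_allRel n h)

theorem cor_rotate_one {l : List F} (hl : 2 ≤ l.length) : cor (l.rotate 1) = cor l := by
  obtain ⟨n, hn⟩ : ∃ n, l.length = n + 2 := ⟨l.length - 2, by omega⟩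
  exact corMod_rotate_one (rel_le_allRel n) hn

theorem cor_rotate {l : List F} (hl : 2 ≤ l.length) (j : ℕ) : cor (l.rotate j) = cor l := by
  induction j with
  | zero => rw [List.rotate_zero]
  | succ j ih => rw [← List.rotate_rotate, cor_rotate_one (by simpa using hl), ih]

theorem cor_append_comm {u v : List F} (h : 2 ≤ u.length + v.length) :
    cor (u ++ v) = cor (v ++ u) := by
  rw [← cor_rotate (by simpa using h) u.length, List.rotate_append_length_eq]

theorem cor_map_mul {c : F} (hc : c ≠ 0) {l : List F} (hl : 3 ≤ l.length) :
    cor (l.map (c * ·)) = cor l := by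
  obtain ⟨n, hn⟩ : ∃ n, l.length = n + 3 := ⟨l.length - 3, by omega⟩
  exact cor_eq_of_mem (gen_scale_sub_mem hc n l hn)

theorem cor_cons_replicate (x : F) {p : ℕ} (hp : 2 ≤ p) : cor (x :: List.replicate p 0) = 0 := by
  obtain ⟨k, rfl⟩ : ∃ k, p = k + 2 := ⟨p - 2, by omega⟩
  exact corMod_eq_zero (rel_le_allRel _ (gen_cons_replicate_mem k x))

theorem cor_classicalWord_sq {r : ℕ} (hr : 1 ≤ r) {z : F} (hz : z ≠ 0) :
    cor (classicalWord r (z ^ 2)) =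
      (2 : ℚ) ^ r • (cor (classicalWord r z) + cor (classicalWord r (-z))) := by
  obtain ⟨n, rfl⟩ : ∃ n, r = n + 1 := ⟨r - 1, by omega⟩
  have h : (allRel F).mkQ (distribution (n + 1) z) = 0 :=
    (Submodule.Quotient.mk_eq_zero _).2 (rel_le_allRel _ (distribution_mem n F z hz))
  rw [mkQ_distribution] at h
  exact sub_eq_zero.1 h

theorem trunc_cor (l : List F) : trunc F (cor l) = if 3 ≤ l.length then cor l else 0 := by
  rw [trunc, cor, Submodule.mkQ_apply, Submodule.mapQ_apply]
  split_ifs with h <;> simp [symbTrunc, gen, h]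

theorem trunc_cor_of_short {l : List F} (hl : l.length ≤ 2) : trunc F (cor l) = 0 := by
  rw [trunc_cor, if_neg (by omega)]

theorem trunc_cor_of_long {l : List F} (hl : 3 ≤ l.length) : trunc F (cor l) = cor l := by
  rw [trunc_cor, if_pos hl]

theorem cobracket_cor (l : List F) : cobracket F (cor l) =
    ∑ j ∈ Finset.range l.length, ∑ i ∈ Finset.Ico 1 (l.length - 1),
      cutWith cor i (l.rotate j) := by
  have h : cobracket F (cor l) = cobracketMod (allRel F) (gen l) := rfl
  rw [h, cobracketMod_gen]
  rfl

/-! ### Iterated truncated cobrackets of correlators -/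

/-- `Δ̄^[k]` of the correlator of a word, which is replaced by zero in weight one. -/
def iterCor (k : ℕ) (l : List F) : TensorAlgebra ℚ (Polylog F) :=
  iterCobracket F k (trunc F (cor l))

/-- The generator of the tensor algebra given by a correlator, which is replaced by zero in
weight one. -/
def ιCor (l : List F) : TensorAlgebra ℚ (Polylog F) := TensorAlgebra.ι ℚ (trunc F (cor l))

theorem iterCor_of_short (k : ℕ) {l : List F} (hl : l.length ≤ 2) : iterCor k l = 0 := by
  rw [iterCor, trunc_cor_of_short hl, map_zero]

theorem ιCor_of_short {l : List F} (hl : l.length ≤ 2) : ιCor l = 0 :=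
  iterCor_of_short 0 hl

/-- The sum over the cuts of a word at its head of `Δ̄^[k]` of the initial part times the final
part. -/
def cutLeft (k : ℕ) : List F → TensorAlgebra ℚ (Polylog F)
  | [] => 0
  | x :: xs => ∑ i ∈ Finset.Ico 1 xs.length, iterCor k (x :: xs.take i) * ιCor (x :: xs.drop i)

/-- The sum over the cuts of a word at its head of `Δ̄^[k]` of the final part times the initial
part. -/
def cutRight (k : ℕ) : List F → TensorAlgebra ℚ (Polylog F)
  | [] => 0
  | x :: xs => ∑ i ∈ Finset.Ico 1 xs.length, iterCor k (x :: xs.drop i) * ιCor (x :: xs.take i)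

theorem iterCor_succ (k : ℕ) (l : List F) :
    iterCor (k + 1) l = ∑ j ∈ Finset.range l.length,
      (cutLeft k (l.rotate j) - cutRight k (l.rotate j)) := by
  have hcut : ∀ i (w : List F), (LinearMap.mul' ℚ (TensorAlgebra ℚ (Polylog F)))
      ((TensorProduct.map (iterCobracket F k) (TensorAlgebra.ι ℚ))
        ((TensorProduct.map (trunc F) (trunc F)) (cutWith cor i w))) =
      match w with
      | [] => 0
      | x :: xs => iterCor k (x :: xs.take i) * ιCor (x :: xs.drop i) -
          iterCor k (x :: xs.drop i) * ιCor (x :: xs.take i) := by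
    intro i w
    cases w with
    | nil => simp [cutWith]
    | cons x xs => simp [cutWith, wedge, iterCor, ιCor]
  have hrot : ∀ w : List F, w.length = l.length →
      ∑ i ∈ Finset.Ico 1 (l.length - 1), (LinearMap.mul' ℚ (TensorAlgebra ℚ (Polylog F)))
      ((TensorProduct.map (iterCobracket F k) (TensorAlgebra.ι ℚ))
        ((TensorProduct.map (trunc F) (trunc F)) (cutWith cor i w))) =
      cutLeft k w - cutRight k w := by
    intro w hw
    simp only [hcut]
    cases w with
    | nil => simp [cutLeft, cutRight]
    | cons x xs =>
      rw [cutLeft, cutRight, ← Finset.sum_sub_distrib, ← hw]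
      rfl
  by_cases hl : 3 ≤ l.length
  · rw [iterCor, trunc_cor_of_long hl, iterCobracket, truncCobracket, LinearMap.comp_apply,
      LinearMap.comp_apply, LinearMap.comp_apply, cobracket_cor]
    simp only [map_sum]
    exact Finset.sum_congr rfl fun j _ => hrot _ (by simp)
  · rw [iterCor_of_short _ (by omega)]
    refine (Finset.sum_eq_zero fun j _ => ?_).symm
    rw [← hrot _ (by simp), Finset.Ico_eq_empty (by omega), Finset.sum_empty]

/-! ### The weight grading -/

theorem weightPart_eq_span (n : ℕ) :
    weightPart F n = Submodule.span ℚ {x | ∃ l : List F, l.length = n + 1 ∧ x = cor l} := by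
  rw [weightPart, homog, Finsupp.supported_eq_span_single, Submodule.map_span]
  congr 1
  ext x
  constructor
  · rintro ⟨_, ⟨l, hl, rfl⟩, rfl⟩
    exact ⟨l, hl, rfl⟩
  · rintro ⟨l, hl, rfl⟩
    exact ⟨_, ⟨l, hl, rfl⟩, rfl⟩

theorem cor_mem_weightPart {n : ℕ} {l : List F} (hl : l.length = n + 1) :
    cor l ∈ weightPart F n := by
  rw [weightPart_eq_span]
  exact Submodule.subset_span ⟨l, hl, rfl⟩

/-- The projection of the space of symbols onto weight `n`. -/
def symbProj (F : Type u) (n : ℕ) : Symb F →ₗ[ℚ] Symb F :=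
  Finsupp.linearCombination ℚ fun l => if l.length = n + 1 then gen l else 0

theorem symbProj_gen {F : Type u} (n : ℕ) (l : List F) :
    symbProj F n (gen l) = if l.length = n + 1 then gen l else 0 := by
  simp [symbProj, gen]

theorem symbProj_of_homog {F : Type u} (n m : ℕ) {r : Symb F} (hr : r ∈ homog F m) :
    symbProj F n r = if m = n then r else 0 := by
  rw [homog, Finsupp.supported_eq_span_single] at hr
  induction hr using Submodule.span_induction with
  | mem x h =>
    obtain ⟨l, hl, rfl⟩ := h
    have := symbProj_gen n l
    rw [gen, hl.out] at this
    rw [this]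
    simp
  | zero => simp
  | add x y _ _ hx hy => rw [map_add, hx, hy]; split_ifs <;> simp
  | smul c x _ hx => rw [map_smul, hx]; split_ifs <;> simp

theorem rel_le_comap_symbProj (n m : ℕ) : rel m F ≤ (rel m F).comap (symbProj F n) := by
  induction m with
  | zero =>
    have h1 : ∀ r : Symb F, LogRelation r → r ∈ homog F 1 → symbProj F n r ∈ rel 0 F := by
      intro r hr h
      rw [symbProj_of_homog n 1 h]
      split_ifs
      · exact logRelation_mem le_rfl hr
      · exact zero_mem _
    rw [rel, Submodule.span_le, ← rel]
    intro r hr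
    rw [SetLike.mem_coe, Submodule.mem_comap]
    cases id hr with
    | short l hl =>
      rw [symbProj_gen]
      split_ifs
      · exact logRelation_mem le_rfl hr
      · exact zero_mem _
    | diag x => exact h1 _ hr (gen_mem_homog rfl)
    | transl x y => exact h1 _ hr (sub_mem (gen_mem_homog rfl) (gen_mem_homog rfl))
    | mul a b ha hb =>
      exact h1 _ hr (sub_mem (sub_mem (gen_mem_homog rfl) (gen_mem_homog rfl)) (gen_mem_homog rfl))
  | succ m ih =>
    have hle : relStep (m + 2) (rel m F) (rel m (RatFunc F)) ≤ homog F (m + 2) := by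
      rw [relStep, Submodule.span_le]
      rintro r ⟨hr, -⟩
      exact hr
    rw [rel]
    refine sup_le (ih.trans (Submodule.comap_mono le_sup_left)) fun r hr => ?_
    rw [Submodule.mem_comap, symbProj_of_homog n _ (hle hr)]
    split_ifs
    · exact Submodule.mem_sup_right hr
    · exact zero_mem _

theorem allRel_le_comap_symbProj (n : ℕ) : allRel F ≤ (allRel F).comap (symbProj F n) :=
  iSup_le fun m => (rel_le_comap_symbProj n m).trans (Submodule.comap_mono (rel_le_allRel m))

/-- The projection of the space of formal polylogarithms onto weight `n`. -/
def weightProj (F : Type u) [Field F] (n : ℕ) : Polylog F →ₗ[ℚ] Polylog F :=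
  (allRel F).mapQ (allRel F) (symbProj F n) (allRel_le_comap_symbProj n)

theorem weightProj_cor (n : ℕ) (l : List F) :
    weightProj F n (cor l) = if l.length = n + 1 then cor l else 0 := by
  rw [weightProj, cor, Submodule.mkQ_apply, Submodule.mapQ_apply, symbProj_gen]
  split_ifs <;> simp

theorem weightProj_of_mem_weightPart (n m : ℕ) {x : Polylog F} (hx : x ∈ weightPart F m) :
    weightProj F n x = if m = n then x else 0 := by
  obtain ⟨r, hr, rfl⟩ := hx
  rw [weightProj, Submodule.mkQ_apply, Submodule.mapQ_apply, symbProj_of_homog n m hr]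
  split_ifs <;> simp

end Correlators

/-! ### Words and multiple polylogarithms -/

section Words

variable {F : Type u} [Field F]

open Classical in
/-- The number of nonzero entries of a word; a correlator has depth less than this number. -/
def nonzeroCount (l : List F) : ℕ := l.countP fun x => x ≠ 0

theorem nonzeroCount_append (u v : List F) :
    nonzeroCount (u ++ v) = nonzeroCount u + nonzeroCount v := List.countP_append

theorem nonzeroCount_cons_zero (l : List F) : nonzeroCount (0 :: l) = nonzeroCount l := by
  simp [nonzeroCount]

theorem nonzeroCount_cons {x : F} (hx : x ≠ 0) (l : List F) :
    nonzeroCount (x :: l) = nonzeroCount l + 1 := by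
  simp [nonzeroCount, hx]

theorem nonzeroCount_replicate (n : ℕ) : nonzeroCount (List.replicate n (0 : F)) = 0 := by
  simp [nonzeroCount]

theorem eq_replicate_of_nonzeroCount_eq_zero {l : List F} (h : nonzeroCount l = 0) :
    l = List.replicate l.length 0 := by
  rw [List.eq_replicate_iff]
  simpa [nonzeroCount] using h

theorem exists_ne_zero_of_nonzeroCount {l : List F} (h : nonzeroCount l ≠ 0) :
    ∃ s t y, y ≠ 0 ∧ l = s ++ y :: t := by
  have h' : ∃ y ∈ l, y ≠ 0 := by
    by_contra hne
    push Not at hne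
    exact h (by simpa [nonzeroCount] using hne)
  obtain ⟨y, hy, hy0⟩ := h'
  obtain ⟨s, t, rfl⟩ := List.append_of_mem hy
  exact ⟨s, t, y, hy0, rfl⟩

/-- The word `0^{n₀} u₁ 0^{n₁ - 1} u₂ 0^{n₂ - 1} ⋯ u_d 0^{n_d - 1}`. -/
def blockWord {d : ℕ} (n₀ : ℕ) (n : Fin d → ℕ) (u : Fin d → F) : List F :=
  List.replicate n₀ 0 ++ (List.ofFn fun i => u i :: List.replicate (n i - 1) 0).flatten

theorem length_blockWord {d : ℕ} (n₀ : ℕ) {n : Fin d → ℕ} (hn : ∀ i, 1 ≤ n i) (u : Fin d → F) :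
    (blockWord n₀ n u).length = n₀ + ∑ i, n i := by
  have h : ∀ i, n i - 1 + 1 = n i := fun i => Nat.sub_add_cancel (hn i)
  simp [blockWord, List.length_flatten, List.map_ofFn, List.sum_ofFn, h]

theorem map_blockWord {d : ℕ} (n₀ : ℕ) (n : Fin d → ℕ) (u : Fin d → F) (c : F) :
    (blockWord n₀ n u).map (c * ·) = blockWord n₀ n fun i => c * u i := by
  simp [blockWord, List.map_flatten, List.map_ofFn, Function.comp_def]

theorem nonzeroCount_blockWord {d : ℕ} (n₀ : ℕ) (n : Fin d → ℕ) (u : Fin d → Fˣ) :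
    nonzeroCount (blockWord n₀ n fun i => (u i : F)) = d := by
  rw [blockWord, nonzeroCount_append, nonzeroCount_replicate, zero_add]
  induction d with
  | zero => simp [nonzeroCount]
  | succ d ih =>
    rw [List.ofFn_succ, List.flatten_cons, nonzeroCount_append, nonzeroCount_cons (u 0).ne_zero,
      nonzeroCount_replicate, ih (fun i => n i.succ) fun i => u i.succ]
    omega

theorem exists_eq_blockWord (l : List F) : ∃ (n₀ d : ℕ) (n : Fin d → ℕ) (u : Fin d → Fˣ),
    (∀ i, 1 ≤ n i) ∧ l = blockWord n₀ n fun i => (u i : F) := by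
  induction l with
  | nil => exact ⟨0, 0, Fin.elim0, Fin.elim0, fun i => i.elim0, by simp [blockWord]⟩
  | cons x l ih =>
    obtain ⟨n₀, d, n, u, hn, rfl⟩ := ih
    by_cases hx : x = 0
    · exact ⟨n₀ + 1, d, n, u, hn, by simp [blockWord, hx, List.replicate_succ]⟩
    · refine ⟨0, d + 1, Fin.cons (n₀ + 1) n, Fin.cons (Units.mk0 x hx) u,
        Fin.cases (by simp) (by simpa using hn), by simp [blockWord, List.ofFn_succ]⟩

/-- Units with prescribed partial products, the first one being the empty product. -/
theorem exists_partial_products {d : ℕ} (u : Fin (d + 1) → Fˣ) (hu : u 0 = 1) (y : Fˣ) :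
    ∃ a : Fin (d + 1) → Fˣ,
      (∀ i, ∏ j ∈ Finset.Iio i, (a j : F) = u i) ∧ ∏ j, (a j : F) = y := by
  let v : ℕ → Fˣ := fun n => if h : n < d + 1 then u ⟨n, h⟩ else y
  have hv0 : v 0 = 1 := hu
  refine ⟨fun j => v (j + 1) / v j, fun i => ?_, ?_⟩
  · have h : ∏ j ∈ Finset.Iio i, v ((j : ℕ) + 1) / v j = v i := by
      have h1 := Finset.prod_map (Finset.Iio i) Fin.valEmbedding fun n => v (n + 1) / v n
      rw [Fin.map_valEmbedding_Iio, Nat.Iio_eq_range, Finset.prod_range_div, hv0, div_one] at h1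
      exact h1.symm
    rw [← Units.coe_prod, h]
    simp only [v, dif_pos i.isLt]
  · rw [← Units.coe_prod, Fin.prod_univ_eq_prod_range (fun n => v (n + 1) / v n),
      Finset.prod_range_div, hv0, div_one]
    simp [v]

theorem Li_eq {d : ℕ} (n₀ : ℕ) (n : Fin d → ℕ) (a : Fin d → Fˣ) :
    Li n₀ n a = (-1 : ℚ) ^ d •
      (cor (blockWord n₀ n (fun i => ∏ j ∈ Finset.Iio i, (a j : F)) ++ [∏ j, (a j : F)]) -
        cor (0 :: blockWord n₀ n fun i => ∏ j ∈ Finset.Iio i, (a j : F))) := rfl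

theorem Li_mem_weightPart {d : ℕ} (n₀ : ℕ) {n : Fin d → ℕ} (hn : ∀ i, 1 ≤ n i)
    (a : Fin d → Fˣ) : Li n₀ n a ∈ weightPart F (n₀ + ∑ i, n i) := by
  rw [Li_eq]
  exact Submodule.smul_mem _ _ (sub_mem
    (cor_mem_weightPart (by rw [List.length_append, length_blockWord n₀ hn]; simp))
    (cor_mem_weightPart (by rw [List.length_cons, length_blockWord n₀ hn])))

/-- After scaling, a correlator ending in a nonzero entry is a multiple polylogarithm, up to sign
and a correlator with fewer nonzero entries. -/
theorem exists_cor_eq_Li {d : ℕ} (n₀ : ℕ) {n : Fin (d + 1) → ℕ} (hn : ∀ i, 1 ≤ n i)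
    (u : Fin (d + 1) → Fˣ) (y : Fˣ) (hw : 2 ≤ n₀ + ∑ i, n i) :
    ∃ a u' : Fin (d + 1) → Fˣ, cor (blockWord n₀ n (fun i => (u i : F)) ++ [(y : F)]) =
      (-1 : ℚ) ^ (d + 1) • Li n₀ n a + cor (0 :: blockWord n₀ n fun i => (u' i : F)) := by
  obtain ⟨a, ha, hy⟩ := exists_partial_products (fun i => (u 0)⁻¹ * u i) (by simp) ((u 0)⁻¹ * y)
  refine ⟨a, fun i => (u 0)⁻¹ * u i, ?_⟩
  rw [Li_eq, smul_smul, ← mul_pow, neg_one_mul, neg_neg, one_pow, one_smul, hy, funext ha,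
    sub_add_cancel, ← cor_map_mul (c := (((u 0)⁻¹ : Fˣ) : F)) (Units.ne_zero _)
      (l := blockWord n₀ n (fun i => (u i : F)) ++ [(y : F)])
      (by rw [List.length_append, length_blockWord n₀ hn]; simpa using hw),
    List.map_append, map_blockWord]
  simp

/-! ### The depth filtration -/

theorem depthPart_mono {d e : ℕ} (h : d ≤ e) (n : ℕ) : depthPart F d n ≤ depthPart F e n :=
  Submodule.span_mono fun _ ⟨f, n₀, k, a, h1, h2, hk⟩ => ⟨f, n₀, k, a, h1, h2.trans h, hk⟩

theorem depthPart_zero (n : ℕ) : depthPart F 0 n = ⊥ := by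
  rw [depthPart, Submodule.span_eq_bot]
  rintro x ⟨e, _, _, _, h1, h2, _⟩
  omega

theorem Li_mem_depthPart {d : ℕ} (hd : 1 ≤ d) (n₀ : ℕ) {k : Fin d → ℕ} (hk : ∀ i, 1 ≤ k i)
    (a : Fin d → Fˣ) : Li n₀ k a ∈ depthPart F d (n₀ + ∑ i, k i) :=
  Submodule.subset_span ⟨d, n₀, k, a, hd, le_rfl, hk, rfl, rfl⟩

theorem depthPart_le_weightPart (d n : ℕ) : depthPart F d n ≤ weightPart F n := by
  rw [depthPart, Submodule.span_le]
  rintro x ⟨e, n₀, k, a, -, -, hk, rfl, rfl⟩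
  exact Li_mem_weightPart n₀ hk a

theorem weightProj_mem_depthPart {d : ℕ} (n : ℕ) {x : Polylog F} (hx : x ∈ depthAll F d) :
    weightProj F n x ∈ depthPart F d n := by
  have h : depthAll F d ≤ (depthPart F d n).comap (weightProj F n) := by
    refine iSup_le fun m y hy => ?_
    rw [Submodule.mem_comap, weightProj_of_mem_weightPart n m (depthPart_le_weightPart d m hy)]
    split_ifs with h
    · exact h ▸ hy
    · exact zero_mem _
  exact h hx

theorem cor_eq_zero_of_nonzeroCount {l : List F} (hl : 3 ≤ l.length) (h : nonzeroCount l ≤ 1) :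
    cor l = 0 := by
  by_cases h0 : nonzeroCount l = 0
  · obtain ⟨k, hk⟩ : ∃ k, l.length = k + 1 := ⟨l.length - 1, by omega⟩
    rw [eq_replicate_of_nonzeroCount_eq_zero h0, hk, List.replicate_succ,
      cor_cons_replicate 0 (by omega)]
  · obtain ⟨s, t, y, hy, rfl⟩ := exists_ne_zero_of_nonzeroCount h0
    rw [nonzeroCount_append, nonzeroCount_cons hy] at h
    have hts := eq_replicate_of_nonzeroCount_eq_zero
      (l := t ++ s) (by rw [nonzeroCount_append]; omega)
    simp only [List.length_append, List.length_cons] at hl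
    rw [cor_append_comm (by simp; omega), List.cons_append, hts,
      cor_cons_replicate y (by simp; omega)]

theorem cor_mem_depthPart (d : ℕ) : ∀ {n : ℕ} {l : List F}, 2 ≤ n → l.length = n + 1 →
    nonzeroCount l ≤ d + 1 → cor l ∈ depthPart F d n := by
  induction d with
  | zero =>
    intro n l hn hl h
    rw [cor_eq_zero_of_nonzeroCount (by omega) h]
    exact zero_mem _
  | succ d ih =>
    intro n l hn hl h
    by_cases hd : nonzeroCount l ≤ d + 1
    · exact depthPart_mono d.le_succ n (ih hn hl hd)
    obtain ⟨s, t, y, hy, rfl⟩ := exists_ne_zero_of_nonzeroCount (l := l) (by omega)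
    rw [nonzeroCount_append, nonzeroCount_cons hy] at h hd
    simp only [List.length_append, List.length_cons] at hl
    have hrot : cor (s ++ y :: t) = cor ((t ++ s) ++ [y]) := by
      rw [cor_append_comm (by simp; omega), List.cons_append,
        ← cor_rotate_one (l := y :: (t ++ s)) (by simp; omega)]
      simp
    obtain ⟨n₀, e, k, u, hk, hts⟩ := exists_eq_blockWord (t ++ s)
    have he : e = d + 1 := by
      rw [← nonzeroCount_blockWord n₀ k u, ← hts, nonzeroCount_append]
      omega
    subst he
    have hlen : n₀ + ∑ i, k i = n := by
      rw [← length_blockWord n₀ hk fun i => (u i : F), ← hts, List.length_append]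
      omega
    obtain ⟨a, u', hcor⟩ := exists_cor_eq_Li n₀ hk u (Units.mk0 y hy) (by omega)
    rw [Units.val_mk0, ← hts] at hcor
    rw [hrot, hcor]
    refine add_mem (Submodule.smul_mem _ _ ?_) (depthPart_mono d.le_succ n (ih hn ?_ ?_))
    · rw [← hlen]
      exact Li_mem_depthPart (by omega) n₀ hk a
    · rw [List.length_cons, length_blockWord n₀ hk, hlen]
    · rw [nonzeroCount_cons_zero, nonzeroCount_blockWord]

theorem weightPart_le_depthPart {n : ℕ} (hn : 2 ≤ n) : weightPart F n ≤ depthPart F n n := by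
  rw [weightPart_eq_span, Submodule.span_le]
  rintro x ⟨l, hl, rfl⟩
  refine cor_mem_depthPart n hn hl ?_
  rw [← hl]
  exact List.countP_le_length

/-- Modulo smaller depth, a correlator ending in a nonzero entry is a multiple polylogarithm. -/
theorem exists_cor_sub_Li_mem {d : ℕ} (n₀ : ℕ) {n : Fin (d + 1) → ℕ} (hn : ∀ i, 1 ≤ n i)
    (u : Fin (d + 1) → Fˣ) (y : Fˣ) (hw : 2 ≤ n₀ + ∑ i, n i) :
    ∃ a : Fin (d + 1) → Fˣ, cor (blockWord n₀ n (fun i => (u i : F)) ++ [(y : F)]) -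
      (-1 : ℚ) ^ (d + 1) • Li n₀ n a ∈ depthPart F d (n₀ + ∑ i, n i) := by
  obtain ⟨a, u', h⟩ := exists_cor_eq_Li n₀ hn u y hw
  refine ⟨a, ?_⟩
  rw [h, add_sub_cancel_left]
  exact cor_mem_depthPart d hw (by rw [List.length_cons, length_blockWord n₀ hn])
    (by rw [nonzeroCount_cons_zero, nonzeroCount_blockWord])

/-- The word `x₀ x₁ ⋯ x_k 0^m`. -/
def tailWord {k : ℕ} (x : Fin k → Fˣ) (m : ℕ) : List F :=
  List.ofFn (fun i => (x i : F)) ++ List.replicate m 0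

@[simp] theorem length_tailWord {k : ℕ} (x : Fin k → Fˣ) (m : ℕ) :
    (tailWord x m).length = k + m := by
  simp [tailWord]

theorem blockWord_one {d : ℕ} (n₀ : ℕ) (u : Fin d → F) :
    blockWord n₀ (fun _ => 1) u = List.replicate n₀ 0 ++ List.ofFn u := by
  rw [blockWord]
  congr 1
  induction d with
  | zero => simp
  | succ d ih => simpa [List.ofFn_succ] using ih fun i => u i.succ

theorem blockWord_hook {d : ℕ} (m : ℕ) (u : Fin (d + 1) → F) :
    blockWord 0 (fun i => if (i : ℕ) = 0 then m + 1 else 1) u =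
      u 0 :: (List.replicate m 0 ++ List.ofFn fun i => u i.succ) := by
  have h := blockWord_one 0 fun i : Fin d => u i.succ
  rw [blockWord, List.replicate_zero, List.nil_append] at h ⊢
  rw [List.nil_append] at h
  rw [List.ofFn_succ, List.flatten_cons, ← h]
  simp

theorem cor_tailWord_mem_ones {d m : ℕ} (hn : 2 ≤ d + 1 + m) (x : Fin (d + 2) → Fˣ) :
    cor (tailWord x m) ∈
      Submodule.span ℚ {z | ∃ a : Fin (d + 1) → Fˣ, z = LiOnes (d + 1 + m) (d + 1) a} ⊔
        depthPart F d (d + 1 + m) := by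
  have hsum : m + ∑ _i : Fin (d + 1), 1 = d + 1 + m := by simp; omega
  obtain ⟨a, ha⟩ := exists_cor_sub_Li_mem m (n := fun _ : Fin (d + 1) => 1) (fun _ => le_rfl)
    (fun i => x i.castSucc) (x (Fin.last _)) (by omega)
  have hword : cor (tailWord x m) = cor (blockWord m (fun _ => 1)
      (fun i : Fin (d + 1) => (x i.castSucc : F)) ++ [(x (Fin.last _) : F)]) := by
    rw [tailWord, cor_append_comm (by simp; omega), blockWord_one, List.append_assoc,
      List.ofFn_succ' (fun i => (x i : F)), List.concat_eq_append]
  rw [hword, ← sub_add_cancel (cor _) ((-1 : ℚ) ^ (d + 1) • Li m (fun _ => 1) a), add_comm (_ - _)]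
  refine Submodule.add_mem_sup (Submodule.smul_mem _ _ (Submodule.subset_span ⟨a, ?_⟩)) ?_
  · rw [LiOnes, Nat.add_sub_cancel_left]
  · rwa [hsum] at ha

theorem cor_tailWord_mem_hook {d m : ℕ} (hn : 2 ≤ d + 1 + m) (x : Fin (d + 2) → Fˣ) :
    cor (tailWord x m) ∈
      Submodule.span ℚ {z | ∃ a : Fin (d + 1) → Fˣ, z = LiHook (d + 1 + m) (d + 1) a} ⊔
        depthPart F d (d + 1 + m) := by
  have hsum : 0 + ∑ i : Fin (d + 1), (if (i : ℕ) = 0 then m + 1 else 1) = d + 1 + m := by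
    rw [Fin.sum_univ_succ]; simp; omega
  obtain ⟨a, ha⟩ := exists_cor_sub_Li_mem 0
    (n := fun i : Fin (d + 1) => if (i : ℕ) = 0 then m + 1 else 1)
    (fun i => by split_ifs <;> omega)
    (Fin.cons (x (Fin.last _)) fun i : Fin d => x i.castSucc.castSucc) (x (Fin.last d).castSucc)
    (by omega)
  have hword : cor (tailWord x m) = cor (blockWord 0
      (fun i : Fin (d + 1) => if (i : ℕ) = 0 then m + 1 else 1)
      (fun i => ((Fin.cons (x (Fin.last _)) (fun i : Fin d => x i.castSucc.castSucc) :
        Fin (d + 1) → Fˣ) i : F)) ++ [(x (Fin.last d).castSucc : F)]) := by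
    rw [tailWord, blockWord_hook, List.ofFn_succ' (fun i => (x i : F)), List.concat_eq_append,
      List.append_assoc, cor_append_comm (by simp; omega),
      List.ofFn_succ' (fun i : Fin (d + 1) => (x i.castSucc : F)), List.concat_eq_append]
    simp
  rw [hword, ← sub_add_cancel (cor _)
    ((-1 : ℚ) ^ (d + 1) • Li 0 (fun i => if (i : ℕ) = 0 then m + 1 else 1) a), add_comm (_ - _)]
  refine Submodule.add_mem_sup (Submodule.smul_mem _ _ (Submodule.subset_span ⟨a, ?_⟩)) ?_
  · rw [LiHook, Nat.add_sub_cancel_left]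
  · rwa [hsum] at ha

end Words

/-! ### The iterated cobracket of a word with one block of zeros -/

section Formula

variable {F : Type u} [Field F]

theorem iterCor_append_comm (k : ℕ) {u v : List F} (h : 2 ≤ u.length + v.length) :
    iterCor k (u ++ v) = iterCor k (v ++ u) := by
  rw [iterCor, cor_append_comm h, iterCor]

theorem ιCor_of_nonzeroCount {l : List F} (h : nonzeroCount l ≤ 1) : ιCor l = 0 := by
  by_cases hl : 3 ≤ l.length
  · rw [ιCor, cor_eq_zero_of_nonzeroCount hl h, map_zero, map_zero]
  · exact ιCor_of_short (by omega)

/-- By the depth conjecture, `Δ̄^[k]` vanishes in depth at most `k`. -/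
theorem iterCor_of_nonzeroCount (hdepth : ∀ d, depthAll F d ≤ LinearMap.ker (iterCobracket F d))
    {k : ℕ} {l : List F} (h : nonzeroCount l ≤ k + 1) : iterCor k l = 0 := by
  by_cases hl : 3 ≤ l.length
  · obtain ⟨n, hn⟩ : ∃ n, l.length = n + 1 := ⟨l.length - 1, by omega⟩
    rw [iterCor, trunc_cor_of_long hl]
    exact hdepth k (Submodule.mem_iSup_of_mem n (cor_mem_depthPart k (by omega) hn h))
  · exact iterCor_of_short k (by omega)

theorem iterCor_mul_ιCor (hdepth : ∀ d, depthAll F d ≤ LinearMap.ker (iterCobracket F d))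
    {k : ℕ} {u v : List F} (h : nonzeroCount u ≤ k + 1 ∨ nonzeroCount v ≤ 1) :
    iterCor k u * ιCor v = 0 := by
  rcases h with h | h
  · rw [iterCor_of_nonzeroCount hdepth h, zero_mul]
  · rw [ιCor_of_nonzeroCount h, mul_zero]

theorem nonzeroCount_take_add_drop (i : ℕ) (l : List F) :
    nonzeroCount (l.take i) + nonzeroCount (l.drop i) = nonzeroCount l := by
  rw [← nonzeroCount_append, List.take_append_drop]

theorem nonzeroCount_cons_le (x : F) (l : List F) :
    nonzeroCount (x :: l) ≤ nonzeroCount l + 1 := by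
  by_cases hx : x = 0
  · rw [hx, nonzeroCount_cons_zero]; omega
  · rw [nonzeroCount_cons hx]

/-- Cuts at a zero do not contribute: the depths of the two parts add up to one less than those of
the parts of a cut at a nonzero entry. -/
theorem cut_zero_cons (hdepth : ∀ d, depthAll F d ≤ LinearMap.ker (iterCobracket F d))
    {k : ℕ} {xs : List F} (h : nonzeroCount xs ≤ k + 3) :
    cutLeft k (0 :: xs) = 0 ∧ cutRight k (0 :: xs) = 0 := by
  constructor <;>
  · refine Finset.sum_eq_zero fun i _ => iterCor_mul_ιCor hdepth ?_
    rw [nonzeroCount_cons_zero, nonzeroCount_cons_zero]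
    have := nonzeroCount_take_add_drop i xs
    omega

theorem cutLeft_eq (hdepth : ∀ d, depthAll F d ≤ LinearMap.ker (iterCobracket F d))
    {k : ℕ} (m : ℕ) (z : F) (ys : List F) (y t : F)
    (h : nonzeroCount ys ≤ k) :
    cutLeft k (z :: (ys ++ y :: (List.replicate m 0 ++ [t]))) =
      ∑ p ∈ Finset.HasAntidiagonal.antidiagonal m,
        iterCor k (z :: (ys ++ y :: List.replicate p.1 0)) *
          ιCor (z :: (List.replicate p.2 0 ++ [t])) := by
  rw [cutLeft, ← Finset.sum_Ico_consecutive _ (by omega : 1 ≤ ys.length + 1) (by simp),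
    Finset.sum_eq_zero, zero_add, Finset.sum_Ico_eq_sum_range,
    Finset.Nat.sum_antidiagonal_eq_sum_range_succ_mk]
  · refine Finset.sum_congr (by congr 1; simp; omega) fun s hs => ?_
    rw [Finset.mem_range] at hs
    congr 2
    · rw [add_assoc, List.take_length_add_append, Nat.add_comm 1, List.take_succ_cons,
        List.take_append_of_le_length (by simp; omega), List.take_replicate, min_eq_left (by omega)]
    · rw [add_assoc, List.drop_length_add_append, Nat.add_comm 1, List.drop_succ_cons,
        List.drop_append_of_le_length (by simp; omega), List.drop_replicate]
  · intro i hi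
    rw [Finset.mem_Ico] at hi
    refine iterCor_mul_ιCor hdepth (.inl ?_)
    rw [List.take_append_of_le_length (by omega)]
    have h1 := nonzeroCount_take_add_drop i ys
    have h2 := nonzeroCount_cons_le z (ys.take i)
    omega

theorem cutRight_eq (hdepth : ∀ d, depthAll F d ≤ LinearMap.ker (iterCobracket F d))
    {k : ℕ} (m : ℕ) (z : F) (ys : List F) (y t : F)
    (h : nonzeroCount ys ≤ k) :
    cutRight k (z :: t :: (List.replicate m 0 ++ y :: ys)) =
      ∑ p ∈ Finset.HasAntidiagonal.antidiagonal m,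
        iterCor k (z :: (List.replicate p.1 0 ++ y :: ys)) *
          ιCor (z :: t :: List.replicate p.2 0) := by
  rw [cutRight, ← Finset.sum_Ico_consecutive _ (by omega : 1 ≤ m + 2) (by simp),
    Finset.sum_eq_zero (s := Finset.Ico (m + 2) _), add_zero, Finset.sum_Ico_eq_sum_range,
    Finset.Nat.sum_antidiagonal_eq_sum_range_succ_mk, ← Finset.sum_range_reflect]
  · refine Finset.sum_congr rfl fun s hs => ?_
    rw [Finset.mem_range] at hs
    rw [Nat.add_comm 1, List.take_succ_cons, List.drop_succ_cons,
      List.take_append_of_le_length (by simp), List.take_replicate,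
      min_eq_left (by omega), List.drop_append_of_le_length (by simp), List.drop_replicate,
      show m + 2 - 1 - 1 - s = m - s by omega, show m - (m - s) = s by omega]
  · intro i hi
    rw [Finset.mem_Ico] at hi
    refine iterCor_mul_ιCor hdepth (.inl ?_)
    obtain ⟨c, rfl⟩ : ∃ c, i = (m + (c + 1)) + 1 := ⟨i - m - 2, by omega⟩
    have hd : (List.replicate m (0 : F) ++ y :: ys).drop (m + (c + 1)) = ys.drop c := by
      simp [List.drop_append]
    rw [List.drop_succ_cons, hd]
    have h1 := nonzeroCount_take_add_drop c ys
    have h2 := nonzeroCount_cons_le z (ys.drop c)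
    omega

theorem cutLeft_append_pair (hdepth : ∀ d, depthAll F d ≤ LinearMap.ker (iterCobracket F d))
    {k : ℕ} (z : F) (ys : List F) (y t : F) (h : nonzeroCount ys ≤ k) :
    cutLeft k (z :: (ys ++ [y, t])) = 0 := by
  refine (cutLeft_eq hdepth 0 z ys y t h).trans (Finset.sum_eq_zero fun p hp => ?_)
  have hp2 : p.2 = 0 := by
    have := Finset.HasAntidiagonal.mem_antidiagonal.1 hp
    omega
  rw [hp2, ιCor_of_short (by simp), mul_zero]

theorem cutRight_cons_pair (hdepth : ∀ d, depthAll F d ≤ LinearMap.ker (iterCobracket F d))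
    {k : ℕ} (z : F) (ys : List F) (y t : F) (h : nonzeroCount ys ≤ k) :
    cutRight k (z :: t :: y :: ys) = 0 := by
  refine (cutRight_eq hdepth 0 z ys y t h).trans (Finset.sum_eq_zero fun p hp => ?_)
  have hp2 : p.2 = 0 := by
    have := Finset.HasAntidiagonal.mem_antidiagonal.1 hp
    omega
  rw [hp2, ιCor_of_short (by simp), mul_zero]

theorem cutLeft_append_replicate
    (hdepth : ∀ d, depthAll F d ≤ LinearMap.ker (iterCobracket F d))
    {k : ℕ} (m : ℕ) (z : F) (ys : List F) (y t : F)
    (h : nonzeroCount ys ≤ k) (h0 : iterCor k (z :: (ys ++ [y])) = 0) :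
    cutLeft k (z :: (ys ++ y :: t :: List.replicate m 0)) = 0 := by
  rw [cutLeft]
  refine Finset.sum_eq_zero fun i hi => ?_
  rw [Finset.mem_Ico] at hi
  rcases lt_trichotomy i (ys.length + 1) with his | his | his
  · refine iterCor_mul_ιCor hdepth (.inl ?_)
    rw [List.take_append_of_le_length (by omega)]
    have h1 := nonzeroCount_take_add_drop i ys
    have h2 := nonzeroCount_cons_le z (ys.take i)
    omega
  · rw [his, List.take_length_add_append, List.take_succ_cons, List.take_zero, h0, zero_mul]
  · refine iterCor_mul_ιCor hdepth (.inr ?_)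
    obtain ⟨c, rfl⟩ : ∃ c, i = ys.length + (c + 1 + 1) := ⟨i - ys.length - 2, by omega⟩
    rw [List.drop_length_add_append, List.drop_succ_cons, List.drop_succ_cons, List.drop_replicate]
    refine (nonzeroCount_cons_le _ _).trans ?_
    rw [nonzeroCount_replicate]

theorem cutRight_replicate_append
    (hdepth : ∀ d, depthAll F d ≤ LinearMap.ker (iterCobracket F d))
    {k : ℕ} (m : ℕ) (z : F) (ys : List F) (y t : F)
    (h : nonzeroCount ys ≤ k) (h0 : iterCor k (z :: y :: ys) = 0) :
    cutRight k (z :: (List.replicate m 0 ++ t :: y :: ys)) = 0 := by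
  rw [cutRight]
  refine Finset.sum_eq_zero fun i hi => ?_
  rw [Finset.mem_Ico] at hi
  rcases lt_trichotomy i (m + 1) with his | his | his
  · refine iterCor_mul_ιCor hdepth (.inr ?_)
    rw [List.take_append_of_le_length (by simp; omega), List.take_replicate]
    refine (nonzeroCount_cons_le _ _).trans ?_
    rw [nonzeroCount_replicate]
  · have hd : (List.replicate m (0 : F) ++ t :: y :: ys).drop i = y :: ys := by
      rw [his]; simp [List.drop_append]
    rw [hd, h0, zero_mul]
  · refine iterCor_mul_ιCor hdepth (.inl ?_)
    obtain ⟨c, rfl⟩ : ∃ c, i = m + (c + 1 + 1) := ⟨i - m - 2, by omega⟩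
    have hd : (List.replicate m (0 : F) ++ t :: y :: ys).drop (m + (c + 1 + 1)) = ys.drop c := by
      simp [List.drop_append]
    rw [hd]
    have h1 := nonzeroCount_take_add_drop c ys
    have h2 := nonzeroCount_cons_le z (ys.drop c)
    omega

theorem exists_append_of_add_three_le {α : Type*} (l : List α) (j : ℕ) (h : j + 3 ≤ l.length) :
    ∃ s p q z t, l = s ++ p :: q :: z :: t ∧ s.length = j := by
  have hd : 3 ≤ (l.drop j).length := by simp; omega
  match hm : l.drop j, hd with
  | p :: q :: z :: t, _ =>
    exact ⟨l.take j, p, q, z, t, by rw [← hm, List.take_append_drop], by simp; omega⟩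

/-- The only cuts that contribute share a nonzero entry and have a part of depth one and weight at
least two; such a part contains the block of zeros, or a piece of it, between its two nonzero
entries, which are the first two or the last two letters of `X`. -/
theorem iterCor_succ_append_replicate
    (hdepth : ∀ d, depthAll F d ≤ LinearMap.ker (iterCobracket F d)) {k : ℕ}
    (h0 : ∀ Y : List F, (∀ y ∈ Y, y ≠ 0) → Y.length = k + 2 → iterCor k Y = 0) (m : ℕ)
    {X S T : List F} {a b c d : F} (hX0 : ∀ x ∈ X, x ≠ 0) (hX : X.length = k + 3)
    (hT : X = a :: b :: T) (hS : X = S ++ [c, d]) :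
    iterCor (k + 1) (X ++ List.replicate m 0) =
      ∑ p ∈ Finset.HasAntidiagonal.antidiagonal m, iterCor k (b :: T ++ List.replicate p.1 0) *
        ιCor (b :: (List.replicate p.2 0 ++ [a])) -
      ∑ p ∈ Finset.HasAntidiagonal.antidiagonal m, iterCor k (S ++ c :: List.replicate p.1 0) *
        ιCor (d :: (List.replicate p.2 0 ++ [c])) := by
  have hnz : ∀ u : List F, nonzeroCount u ≤ u.length := fun u => List.countP_le_length
  -- rotations starting with a zero
  have hlate : ∀ j, k + 3 ≤ j → j < (X ++ List.replicate m (0 : F)).length →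
      cutLeft k ((X ++ List.replicate m 0).rotate j) = 0 ∧
      cutRight k ((X ++ List.replicate m 0).rotate j) = 0 := by
    intro j hj hjl
    rw [List.length_append, List.length_replicate] at hjl
    obtain ⟨s, rfl⟩ : ∃ s, j = X.length + s := ⟨j - X.length, by omega⟩
    obtain ⟨r, rfl⟩ : ∃ r, m = s + (r + 1) := ⟨m - s - 1, by omega⟩
    have hrot : (X ++ List.replicate (s + (r + 1)) (0 : F)).rotate (X.length + s) =
        0 :: (List.replicate r 0 ++ (X ++ List.replicate s 0)) := by
      have h := List.rotate_append_length_eq (X ++ List.replicate s (0 : F))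
        (List.replicate (r + 1) 0)
      rw [List.append_assoc, List.replicate_append_replicate, List.length_append,
        List.length_replicate, List.replicate_succ, List.cons_append] at h
      exact h
    rw [hrot]
    refine cut_zero_cons hdepth ?_
    rw [nonzeroCount_append, nonzeroCount_append, nonzeroCount_replicate, nonzeroCount_replicate]
    have := hnz X
    omega
  rw [iterCor_succ, Finset.sum_sub_distrib]
  congr 1
  · rw [Finset.sum_eq_single 1]
    · obtain ⟨ys, y, rfl⟩ : ∃ ys y, T = ys ++ [y] := by
        rcases List.eq_nil_or_concat T with h | ⟨ys, y, h⟩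
        · subst hT h; simp at hX
        · exact ⟨ys, y, by simpa using h⟩
      have hlen : ys.length = k := by
        rw [hT] at hX; simp at hX; omega
      have hrot : (X ++ List.replicate m (0 : F)).rotate 1 =
          b :: (ys ++ y :: (List.replicate m 0 ++ [a])) := by
        rw [hT]; simp
      rw [hrot, cutLeft_eq hdepth m b ys y a (hlen ▸ hnz ys)]
      simp
    · intro j hj hj1
      rw [Finset.mem_range] at hj
      by_cases hjk : k + 3 ≤ j
      · exact (hlate j hjk hj).1
      rcases Nat.eq_zero_or_pos j with rfl | hj0
      -- the block of zeros comes last: the other part has no zeros, and `h0` applies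
      · obtain ⟨ys, y, t, hys⟩ : ∃ ys y t, X = a :: (ys ++ [y, t]) := by
          cases S with
          | nil => subst hS; simp at hX
          | cons s S =>
            rw [hS] at hT
            exact ⟨S, c, d, by rw [hS]; simp at hT ⊢; exact hT.1⟩
        have hlen : ys.length = k := by
          rw [hys] at hX; simp at hX; omega
        have hrot : (X ++ List.replicate m (0 : F)).rotate 0 =
            a :: (ys ++ y :: t :: List.replicate m 0) := by
          rw [hys]; simp
        rw [hrot]
        refine cutLeft_append_replicate hdepth m a ys y t (hlen ▸ hnz ys) (h0 _ ?_ (by simp [hlen]))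
        intro x hx
        refine hX0 x ?_
        rw [hys]
        simp only [List.mem_cons, List.mem_append, List.not_mem_nil, or_false] at hx ⊢
        tauto
      -- the word ends in two nonzero letters: the part of depth one has weight one
      · obtain ⟨s, p, q, z, t, hs, hsl⟩ := exists_append_of_add_three_le X (j - 2) (by omega)
        have hrot : (X ++ List.replicate m (0 : F)).rotate j =
            z :: ((t ++ List.replicate m 0 ++ s) ++ [p, q]) := by
          have h := List.rotate_append_length_eq (s ++ [p, q]) (z :: t ++ List.replicate m (0 : F))
          rw [List.length_append, hsl, List.length_cons, List.length_cons, List.length_nil,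
            show j - 2 + (0 + 1 + 1) = j by omega] at h
          rw [hs]
          simpa using h
        rw [hrot]
        refine cutLeft_append_pair hdepth z _ p q ?_
        rw [nonzeroCount_append, nonzeroCount_append, nonzeroCount_replicate]
        have h1 := hnz s
        have h2 := hnz t
        rw [hs] at hX
        simp at hX
        omega
    · intro h
      simp [hX] at h; omega
  · rw [Finset.sum_eq_single (k + 1)]
    · have hSl : S.length = k + 1 := by
        rw [hS] at hX; simpa using hX
      have hrot : (X ++ List.replicate m (0 : F)).rotate (k + 1) =
          c :: d :: (List.replicate m 0 ++ S) := by
        have h := List.rotate_append_length_eq S (c :: d :: List.replicate m (0 : F))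
        rw [hSl] at h
        rw [hS]
        simpa using h
      obtain ⟨y, ys, rfl⟩ : ∃ y ys, S = y :: ys := by
        cases S with
        | nil => simp at hSl
        | cons y ys => exact ⟨y, ys, rfl⟩
      have hlen : ys.length = k := by simpa using hSl
      rw [hrot, cutRight_eq hdepth m c ys y d (hlen ▸ hnz ys)]
      refine Finset.sum_congr rfl fun p _ => ?_
      congr 1
      · exact iterCor_append_comm k (u := c :: List.replicate p.1 0) (v := y :: ys) (by simp; omega)
      · exact iterCor_append_comm 0 (u := [c]) (v := d :: List.replicate p.2 0) (by simp; omega)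
    · intro j hj hj1
      rw [Finset.mem_range] at hj
      by_cases hjk : k + 3 ≤ j
      · exact (hlate j hjk hj).2
      by_cases hj2 : j = k + 2
      -- the block of zeros comes right after the head: the other part has no zeros
      · subst hj2
        obtain ⟨t, y, ys, hys⟩ : ∃ t y ys, S ++ [c] = t :: y :: ys := by
          have hl : (S ++ [c]).length = k + 2 := by
            rw [hS] at hX; simp at hX ⊢; omega
          match S ++ [c], hl with
          | t :: y :: ys, _ => exact ⟨t, y, ys, rfl⟩
        have hS' : X = t :: y :: ys ++ [d] := by rw [← hys, hS]; simp
        have hlen : ys.length = k := by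
          rw [hS'] at hX; simpa using hX
        have hrot : (X ++ List.replicate m (0 : F)).rotate (k + 2) =
            d :: (List.replicate m 0 ++ t :: y :: ys) := by
          have h := List.rotate_append_length_eq (t :: y :: ys) (d :: List.replicate m (0 : F))
          rw [List.length_cons, List.length_cons, hlen] at h
          rw [hS']
          simpa using h
        rw [hrot]
        refine cutRight_replicate_append hdepth m d ys y t (hlen ▸ hnz ys)
          (h0 _ ?_ (by simp [hlen]))
        intro x hx
        refine hX0 x ?_
        rw [hS']
        simp only [List.mem_cons, List.mem_append, List.not_mem_nil, or_false] at hx ⊢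
        tauto
      -- the head is followed by two nonzero letters: the part of depth one has weight one
      · obtain ⟨s, z, p, q, t, hs, hsl⟩ := exists_append_of_add_three_le X j (by omega)
        have hrot : (X ++ List.replicate m (0 : F)).rotate j =
            z :: p :: q :: (t ++ List.replicate m 0 ++ s) := by
          have h := List.rotate_append_length_eq s (z :: p :: q :: t ++ List.replicate m (0 : F))
          rw [hsl] at h
          rw [hs]
          simpa using h
        rw [hrot]
        refine cutRight_cons_pair hdepth z _ q p ?_
        rw [nonzeroCount_append, nonzeroCount_append, nonzeroCount_replicate]
        have h1 := hnz s
        have h2 := hnz t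
        rw [hs] at hX
        simp at hX
        omega
    · intro h
      simp [hX] at h; omega

theorem exists_eq_ofFn_units {n : ℕ} {l : List F} (h : ∀ x ∈ l, x ≠ 0) (hl : l.length = n) :
    ∃ x : Fin n → Fˣ, l = List.ofFn fun i => (x i : F) := by
  subst hl
  exact ⟨fun i => Units.mk0 l[i] (h _ (List.getElem_mem _)), by simp⟩

theorem sum_antidiagonalTuple_cons {M : Type*} [AddCommMonoid M] (k m : ℕ)
    (f : ℕ → (Fin (k + 1) → ℕ) → M) :
    ∑ r ∈ Finset.Nat.antidiagonalTuple (k + 2) m, f (r 0) (Fin.tail r) =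
      ∑ p ∈ Finset.HasAntidiagonal.antidiagonal m,
        ∑ r ∈ Finset.Nat.antidiagonalTuple (k + 1) p.1, f p.2 r := by
  rw [Finset.sum_sigma']
  refine Finset.sum_bij' (fun r _ => ⟨(∑ i, Fin.tail r i, r 0), Fin.tail r⟩)
    (fun q _ => Fin.cons q.1.2 q.2) ?_ ?_ ?_ ?_ ?_
  · intro r hr
    rw [Finset.Nat.mem_antidiagonalTuple, Fin.sum_univ_succ] at hr
    simp only [Finset.mem_sigma, Finset.HasAntidiagonal.mem_antidiagonal,
      Finset.Nat.mem_antidiagonalTuple, and_true]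
    rw [add_comm]
    exact hr
  · rintro ⟨⟨p, q⟩, r⟩ h
    simp only [Finset.mem_sigma, Finset.HasAntidiagonal.mem_antidiagonal,
      Finset.Nat.mem_antidiagonalTuple] at h
    rw [Finset.Nat.mem_antidiagonalTuple, Fin.sum_univ_succ]
    simp [h.2, ← h.1, add_comm]
  · intro r _
    exact Fin.cons_self_tail r
  · rintro ⟨⟨p, q⟩, r⟩ h
    simp only [Finset.mem_sigma, Finset.HasAntidiagonal.mem_antidiagonal,
      Finset.Nat.mem_antidiagonalTuple] at h
    simp [h.2]
  · intro r _
    rfl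

theorem sum_antidiagonalTuple_snoc {M : Type*} [AddCommMonoid M] (k m : ℕ)
    (f : ℕ → (Fin (k + 1) → ℕ) → M) :
    ∑ r ∈ Finset.Nat.antidiagonalTuple (k + 2) m, f (r (Fin.last _)) (Fin.init r) =
      ∑ p ∈ Finset.HasAntidiagonal.antidiagonal m,
        ∑ r ∈ Finset.Nat.antidiagonalTuple (k + 1) p.1, f p.2 r := by
  rw [Finset.sum_sigma']
  refine Finset.sum_bij' (fun r _ => ⟨(∑ i, Fin.init r i, r (Fin.last _)), Fin.init r⟩)
    (fun q _ => Fin.snoc q.2 q.1.2) ?_ ?_ ?_ ?_ ?_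
  · intro r hr
    rw [Finset.Nat.mem_antidiagonalTuple, Fin.sum_univ_castSucc] at hr
    simp only [Finset.mem_sigma, Finset.HasAntidiagonal.mem_antidiagonal,
      Finset.Nat.mem_antidiagonalTuple, and_true]
    exact hr
  · rintro ⟨⟨p, q⟩, r⟩ h
    simp only [Finset.mem_sigma, Finset.HasAntidiagonal.mem_antidiagonal,
      Finset.Nat.mem_antidiagonalTuple] at h
    rw [Finset.Nat.mem_antidiagonalTuple, Fin.sum_univ_castSucc]
    simp [h.2, ← h.1]
  · intro r _
    exact Fin.snoc_init_self r
  · rintro ⟨⟨p, q⟩, r⟩ h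
    simp only [Finset.mem_sigma, Finset.HasAntidiagonal.mem_antidiagonal,
      Finset.Nat.mem_antidiagonalTuple] at h
    simp [h.2]
  · intro r _
    rfl

/-- The correlator of `(b, 0^r, a)`, which is replaced by zero in weight one; it is
`-Li_{r+1}(a / b)` in weight at least two. -/
def pairCor (r : ℕ) (a b : F) : Polylog F := trunc F (cor (b :: (List.replicate r 0 ++ [a])))

/-- The word `L₁ ⋯ L_{k+1}` of the cofree Lie coalgebra whose `i`-th letter is given by
`(xᵢ, 0^{rᵢ}, xᵢ₋₁)`. -/
def pairWord {k : ℕ} (r : Fin (k + 1) → ℕ) (x : Fin (k + 2) → Fˣ) :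
    TensorAlgebra ℚ (Polylog F) :=
  coLieWord k fun i => pairCor (r i) (x i.castSucc : F) (x i.succ)

theorem pairWord_zero {k : ℕ} (x : Fin (k + 2) → Fˣ) : pairWord 0 x = 0 := by
  have h : ∀ a b : F, pairCor 0 a b = 0 := fun a b => trunc_cor_of_short (by simp)
  cases k <;> simp [pairWord, h, coLieWord]

theorem pairWord_succ {k : ℕ} (r : Fin (k + 2) → ℕ) (x : Fin (k + 3) → Fˣ) :
    pairWord r x = pairWord (Fin.init r) (Fin.init x) *
        ιCor ((x (Fin.last (k + 2)) : F) :: (List.replicate (r (Fin.last (k + 1))) 0 ++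
          [(x (Fin.last (k + 1)).castSucc : F)])) -
      pairWord (Fin.tail r) (Fin.tail x) *
        ιCor ((x 1 : F) :: (List.replicate (r 0) 0 ++ [(x 0 : F)])) := rfl

/-- Up to sign, the iterated cobracket of `Cor(x₀, …, x_{k+1}, 0^m)` is the sum of the words with
letters `Li_{r₁+1}(x₀ / x₁), …, Li_{r_{k+1}+1}(x_k / x_{k+1})` over all distributions `r` of the
`m` zeros such that no `rᵢ` vanishes. -/
theorem iterCor_tailWord (hdepth : ∀ d, depthAll F d ≤ LinearMap.ker (iterCobracket F d)) (k : ℕ) :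
    ∀ (x : Fin (k + 2) → Fˣ) (m : ℕ), iterCor k (tailWord x m) =
      (-1 : ℚ) ^ k • ∑ r ∈ Finset.Nat.antidiagonalTuple (k + 1) m, pairWord r x := by
  induction k with
  | zero =>
    intro x m
    rw [pow_zero, one_smul, Finset.Nat.antidiagonalTuple_one, Finset.sum_singleton, tailWord,
      iterCor, List.ofFn_succ, List.cons_append, ← cor_rotate_one (by simp)]
    simp [pairWord, coLieWord, pairCor, iterCobracket]
  | succ k ih =>
    intro x m
    have h0 : ∀ Y : List F, (∀ y ∈ Y, y ≠ 0) → Y.length = k + 2 → iterCor k Y = 0 := by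
      intro Y hY hYl
      obtain ⟨y, rfl⟩ := exists_eq_ofFn_units hY hYl
      have h := ih y 0
      rw [tailWord, List.replicate_zero, List.append_nil] at h
      rw [h, Finset.Nat.antidiagonalTuple_zero_right, Finset.sum_singleton, pairWord_zero,
        smul_zero]
    have hT : (List.ofFn fun i => (x i : F)) =
        (x 0 : F) :: (x 1 : F) :: List.ofFn fun i : Fin (k + 1) => (x i.succ.succ : F) := by
      rw [List.ofFn_succ, List.ofFn_succ]
      rfl
    have hS : (List.ofFn fun i => (x i : F)) =
        (List.ofFn fun i : Fin (k + 1) => (x i.castSucc.castSucc : F)) ++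
          [(x (Fin.last (k + 1)).castSucc : F), (x (Fin.last (k + 2)) : F)] := by
      rw [List.ofFn_succ', List.ofFn_succ']
      simp
    rw [tailWord, iterCor_succ_append_replicate hdepth h0 m (by simp) (by simp) hT hS]
    have hleft : ∀ p : ℕ × ℕ, iterCor k ((x 1 : F) :: (List.ofFn fun i : Fin (k + 1) =>
        (x i.succ.succ : F)) ++ List.replicate p.1 0) = (-1 : ℚ) ^ k •
          ∑ r ∈ Finset.Nat.antidiagonalTuple (k + 1) p.1, pairWord r (Fin.tail x) := by
      intro p
      rw [← ih, tailWord, List.ofFn_succ (f := fun i => (Fin.tail x i : F))]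
      rfl
    have hright : ∀ p : ℕ × ℕ, iterCor k ((List.ofFn fun i : Fin (k + 1) =>
        (x i.castSucc.castSucc : F)) ++ (x (Fin.last (k + 1)).castSucc : F) ::
          List.replicate p.1 0) = (-1 : ℚ) ^ k •
          ∑ r ∈ Finset.Nat.antidiagonalTuple (k + 1) p.1, pairWord r (Fin.init x) := by
      intro p
      rw [← ih, tailWord, List.ofFn_succ' (fun i => (Fin.init x i : F))]
      simp [Fin.init]
    simp only [hleft, hright, smul_mul_assoc, Finset.sum_mul]
    simp only [pairWord_succ]
    rw [Finset.sum_sub_distrib,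
      sum_antidiagonalTuple_snoc k m fun c r => pairWord r (Fin.init x) *
        ιCor ((x (Fin.last (k + 2)) : F) :: (List.replicate c 0 ++
          [(x (Fin.last (k + 1)).castSucc : F)])),
      sum_antidiagonalTuple_cons k m fun c r => pairWord r (Fin.tail x) *
        ιCor ((x 1 : F) :: (List.replicate c 0 ++ [(x 0 : F)])),
      ← Finset.smul_sum, ← Finset.smul_sum, ← smul_sub, pow_succ', neg_one_mul, neg_smul,
      ← smul_neg, neg_sub]

end Formula

/-! ### Multilinearity of words in the cofree Lie coalgebra -/

section CoLie

variable {L : Type u} [AddCommGroup L] [Module ℚ L]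

theorem exists_linearMap_coLieWord (k : ℕ) : ∀ (v : Fin (k + 1) → L) (i : Fin (k + 1)),
    ∃ f : L →ₗ[ℚ] TensorAlgebra ℚ L, ∀ x, f x = coLieWord k (Function.update v i x) := by
  induction k with
  | zero =>
    intro v i
    obtain rfl : i = 0 := Fin.fin_one_eq_zero i
    exact ⟨TensorAlgebra.ι ℚ, fun x => by simp [coLieWord]⟩
  | succ k ih =>
    intro v i
    have h1 : ∃ f : L →ₗ[ℚ] TensorAlgebra ℚ L, ∀ x, f x =
        coLieWord k (Fin.init (Function.update v i x)) *
          TensorAlgebra.ι ℚ (Function.update v i x (Fin.last (k + 1))) := by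
      induction i using Fin.lastCases with
      | last =>
        refine ⟨LinearMap.mulLeft ℚ (coLieWord k (Fin.init v)) ∘ₗ TensorAlgebra.ι ℚ, fun x => ?_⟩
        rw [Fin.init_update_last, Function.update_self]
        rfl
      | cast i =>
        obtain ⟨f, hf⟩ := ih (Fin.init v) i
        refine ⟨LinearMap.mulRight ℚ (TensorAlgebra.ι ℚ (v (Fin.last (k + 1)))) ∘ₗ f, fun x => ?_⟩
        rw [Fin.init_update_castSucc, Function.update_of_ne (Fin.castSucc_lt_last i).ne', ← hf]
        rfl
    have h2 : ∃ f : L →ₗ[ℚ] TensorAlgebra ℚ L, ∀ x, f x =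
        coLieWord k (Fin.tail (Function.update v i x)) *
          TensorAlgebra.ι ℚ (Function.update v i x 0) := by
      induction i using Fin.cases with
      | zero =>
        refine ⟨LinearMap.mulLeft ℚ (coLieWord k (Fin.tail v)) ∘ₗ TensorAlgebra.ι ℚ, fun x => ?_⟩
        rw [Fin.tail_update_zero, Function.update_self]
        rfl
      | succ i =>
        obtain ⟨f, hf⟩ := ih (Fin.tail v) i
        refine ⟨LinearMap.mulRight ℚ (TensorAlgebra.ι ℚ (v 0)) ∘ₗ f, fun x => ?_⟩
        rw [Fin.tail_update_succ, Function.update_of_ne (Fin.succ_ne_zero i).symm, ← hf]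
        rfl
    obtain ⟨f, hf⟩ := h1
    obtain ⟨g, hg⟩ := h2
    exact ⟨f - g, fun x => by rw [LinearMap.sub_apply, hf, hg, coLieWord]⟩

theorem coLieWord_mem_of_mem_span {k : ℕ} {S : Set L} {W : Submodule ℚ (TensorAlgebra ℚ L)}
    (h : ∀ v : Fin (k + 1) → L, (∀ i, v i ∈ S) → coLieWord k v ∈ W) (v : Fin (k + 1) → L)
    (hv : ∀ i, v i ∈ Submodule.span ℚ S) : coLieWord k v ∈ W := by
  have key : ∀ (s : Finset (Fin (k + 1))) (v : Fin (k + 1) → L),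
      (∀ i ∈ s, v i ∈ Submodule.span ℚ S) → (∀ i ∉ s, v i ∈ S) → coLieWord k v ∈ W := by
    intro s
    induction s using Finset.induction_on with
    | empty => exact fun v _ hv => h v fun i => hv i (Finset.notMem_empty i)
    | insert i s his ih =>
      intro v hs hns
      obtain ⟨f, hf⟩ := exists_linearMap_coLieWord k v i
      have hle : Submodule.span ℚ S ≤ W.comap f := by
        rw [Submodule.span_le]
        intro y hy
        rw [SetLike.mem_coe, Submodule.mem_comap, hf]
        refine ih _ (fun j hj => ?_) fun j hj => ?_
        · rw [Function.update_of_ne (by rintro rfl; exact his hj)]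
          exact hs j (Finset.mem_insert_of_mem hj)
        · by_cases hji : j = i
          · rw [hji, Function.update_self]
            exact hy
          · rw [Function.update_of_ne hji]
            exact hns j (by simp [hji, hj])
      have hmem := hle (hs i (Finset.mem_insert_self i s))
      rwa [Submodule.mem_comap, hf, Function.update_eq_self] at hmem
  exact key Finset.univ v (fun i _ => hv i) fun i hi => absurd (Finset.mem_univ i) hi

end CoLie

/-! ### Separation of words by the distribution relation -/

/-- If the functions `w r` of `y` satisfy distribution relations with factors `2 ^ r i`, then they
are eigenfunctions of the operators of summation over the square roots of `y i`, with eigenvalues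
`2 ^ (-r i)`; hence they are linearly independent unless they vanish. -/
theorem eq_zero_of_sum_eq_zero {G V ι : Type*} [Fintype ι] [DecidableEq ι] [Monoid G] [Neg G]
    [AddCommGroup V] [Module ℚ V] (hsqrt : ∀ g : G, ∃ z : G, z ^ 2 = g)
    (w : (ι → ℕ) → (ι → G) → V)
    (hw : ∀ r y i z, z ^ 2 = y i → w r y =
      (2 : ℚ) ^ r i • (w r (Function.update y i z) + w r (Function.update y i (-z))))
    (I : Finset (ι → ℕ)) : ∀ c : (ι → ℕ) → ℚ, (∀ r ∈ I, c r ≠ 0) →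
      (∀ y, ∑ r ∈ I, c r • w r y = 0) → ∀ r ∈ I, ∀ y, w r y = 0 := by
  induction I using Finset.strongInduction with
  | H I ih =>
    intro c hc hsum r hr y
    by_cases hex : ∃ s ∈ I, s ≠ r
    · obtain ⟨s, hs, hsr⟩ := hex
      obtain ⟨i, hi⟩ := Function.ne_iff.1 hsr
      -- eliminate `s` by subtracting from the sum over the square roots of `y i` the multiple of
      -- the given sum by the eigenvalue of `w s`
      have hinj : ∀ a b : ℕ, ((2 : ℚ) ^ a)⁻¹ - ((2 : ℚ) ^ b)⁻¹ = 0 → a = b := by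
        intro a b h
        exact pow_right_injective₀ (by norm_num) (by norm_num) (inv_injective (sub_eq_zero.1 h))
      refine ih (I.filter fun t => t i ≠ s i) ?_
        (fun t => c t * (((2 : ℚ) ^ t i)⁻¹ - ((2 : ℚ) ^ s i)⁻¹)) ?_ ?_ r ?_ y
      · exact Finset.filter_ssubset.2 ⟨s, hs, by simp⟩
      · intro t ht
        rw [Finset.mem_filter] at ht
        exact mul_ne_zero (hc t ht.1) fun h => ht.2 (hinj _ _ h)
      · intro y
        rw [Finset.sum_filter_of_ne]
        · obtain ⟨z, hz⟩ := hsqrt (y i)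
          have h1 : ∑ t ∈ I, (c t * ((2 : ℚ) ^ t i)⁻¹) • w t y = 0 := by
            have h2 := congrArg₂ (· + ·) (hsum (Function.update y i z))
              (hsum (Function.update y i (-z)))
            simp only [← Finset.sum_add_distrib, ← smul_add, add_zero] at h2
            rw [← h2]
            refine Finset.sum_congr rfl fun t _ => ?_
            rw [hw t y i z hz, smul_smul, inv_mul_cancel_right₀ (by positivity)]
          have h3 : ∑ t ∈ I, (c t * ((2 : ℚ) ^ s i)⁻¹) • w t y = 0 := by
            simp only [mul_comm (c _), mul_smul]
            rw [← Finset.smul_sum, hsum, smul_zero]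
          simp only [mul_sub, sub_smul]
          rw [Finset.sum_sub_distrib, h1, h3, sub_zero]
        · intro t _ hne hts
          rw [hts, sub_self, mul_zero, zero_smul] at hne
          exact hne rfl
      · exact Finset.mem_filter.2 ⟨hr, fun h => hi h.symm⟩
    · push Not at hex
      have h := hsum y
      rw [Finset.sum_eq_single r (fun t ht hne => absurd (hex t ht) hne)
        (fun h => absurd hr h)] at h
      exact (smul_eq_zero.1 h).resolve_left (hc r hr)

/-! ### Spanning modulo smaller depth -/

section Spanning

variable {F : Type u} [Field F]

/-- The correlator of `(1, 0^r, y)`, which is replaced by zero in weight one; it is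
`-Li_{r+1}(y)` in weight at least two. -/
def classicalCor (r : ℕ) (y : F) : Polylog F := trunc F (cor (classicalWord r y))

theorem classicalCor_zero (y : F) : classicalCor 0 y = 0 := trunc_cor_of_short (by simp)

theorem classicalCor_sq (r : ℕ) {z : F} (hz : z ≠ 0) :
    classicalCor r (z ^ 2) = (2 : ℚ) ^ r • (classicalCor r z + classicalCor r (-z)) := by
  by_cases hr : r = 0
  · simp [hr, classicalCor_zero]
  · rw [classicalCor, cor_classicalWord_sq (by omega) hz, map_smul, map_add]
    rfl

theorem pairCor_eq (r : ℕ) (a b : Fˣ) :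
    pairCor r (a : F) b = classicalCor r ((a / b : Fˣ) : F) := by
  by_cases hr : r = 0
  · rw [hr, classicalCor_zero, pairCor, trunc_cor_of_short (by simp)]
  · rw [pairCor, classicalCor, ← cor_map_mul (c := ((b⁻¹ : Fˣ) : F)) (Units.ne_zero _)
      (l := (b : F) :: (List.replicate r 0 ++ [(a : F)])) (by simp; omega)]
    simp [classicalWord, div_eq_inv_mul]

theorem exists_ratios {n : ℕ} (y : Fin n → Fˣ) :
    ∃ x : Fin (n + 1) → Fˣ, ∀ i, x i.castSucc / x i.succ = y i := by
  induction n with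
  | zero => exact ⟨1, fun i => i.elim0⟩
  | succ n ih =>
    obtain ⟨x, hx⟩ := ih (Fin.tail y)
    refine ⟨Fin.cons (y 0 * x 0) x, Fin.cases (by simp) fun i => ?_⟩
    simpa [Fin.tail] using hx i

/-- The span of the iterated cobrackets of the correlators `Cor(x₀, …, x_{k+1}, 0^m)`. -/
def tailSpan (F : Type u) [Field F] (k : ℕ) : Submodule ℚ (TensorAlgebra ℚ (Polylog F)) :=
  Submodule.span ℚ {z | ∃ (x : Fin (k + 2) → Fˣ) (m : ℕ), z = iterCor k (tailWord x m)}

theorem coLieWord_classicalCor_mem (hF : IsQuadraticallyClosed F)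
    (hdepth : ∀ d, depthAll F d ≤ LinearMap.ker (iterCobracket F d)) (k : ℕ)
    (r : Fin (k + 1) → ℕ) (y : Fin (k + 1) → Fˣ) :
    coLieWord k (fun i => classicalCor (r i) (y i : F)) ∈ tailSpan F k := by
  have hsqrt : ∀ g : Fˣ, ∃ z : Fˣ, z ^ 2 = g := by
    intro g
    obtain ⟨z, hz⟩ := hF.2 (g : F)
    have hz0 : z ≠ 0 := by
      rintro rfl
      exact g.ne_zero (by rw [hz, mul_zero])
    exact ⟨Units.mk0 z hz0, Units.ext (by simp [pow_two, hz])⟩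
  let w : (Fin (k + 1) → ℕ) → (Fin (k + 1) → Fˣ) → TensorAlgebra ℚ (Polylog F) ⧸ tailSpan F k :=
    fun r y => (tailSpan F k).mkQ (coLieWord k fun i => classicalCor (r i) (y i : F))
  have hw : ∀ r y i z, z ^ 2 = y i → w r y =
      (2 : ℚ) ^ r i • (w r (Function.update y i z) + w r (Function.update y i (-z))) := by
    intro r y i z hz
    obtain ⟨f, hf⟩ := exists_linearMap_coLieWord k (fun i => classicalCor (r i) (y i : F)) i
    have hupd : ∀ z : Fˣ, coLieWord k (fun j => classicalCor (r j) (Function.update y i z j : F)) =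
        f (classicalCor (r i) (z : F)) := by
      intro z
      rw [hf]
      congr 1
      ext j
      by_cases hj : j = i
      · subst hj; simp
      · simp [hj]
    have hself := hupd (y i)
    rw [Function.update_eq_self] at hself
    simp only [w]
    rw [hself, hupd, hupd, ← map_add, ← map_add, ← map_smul, ← map_smul, ← hz,
      Units.val_pow_eq_pow_val, Units.val_neg, classicalCor_sq _ z.ne_zero]
  have hmain := eq_zero_of_sum_eq_zero hsqrt w hw
    (Finset.Nat.antidiagonalTuple (k + 1) (∑ i, r i)) (fun _ => 1) (fun _ _ => one_ne_zero) ?_ r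
    (Finset.Nat.mem_antidiagonalTuple.2 rfl) y
  · exact (Submodule.Quotient.mk_eq_zero _).1 hmain
  · intro y
    obtain ⟨x, hx⟩ := exists_ratios y
    have hmem : iterCor k (tailWord x (∑ i, r i)) ∈ tailSpan F k :=
      Submodule.subset_span ⟨x, _, rfl⟩
    rw [iterCor_tailWord hdepth, Submodule.smul_mem_iff _ (by simp)] at hmem
    have h0 := (Submodule.Quotient.mk_eq_zero _).2 hmem
    rw [← Submodule.mkQ_apply, map_sum] at h0
    rw [← h0]
    refine Finset.sum_congr rfl fun s _ => ?_
    simp only [one_smul, w, pairWord, pairCor_eq, hx]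

theorem classicalGeTwo_le_span : classicalGeTwo F ≤
    Submodule.span ℚ {z | ∃ (r : ℕ) (y : Fˣ), z = classicalCor r (y : F)} := by
  refine iSup_le fun n => iSup_le fun hn => ?_
  rw [classicalPart, Submodule.span_le]
  rintro _ ⟨a, rfl⟩
  obtain ⟨r, rfl⟩ : ∃ r, n = r + 2 := ⟨n - 2, by omega⟩
  have h1 : cor ((0 : F) :: 1 :: List.replicate (r + 1) 0) = 0 :=
    cor_eq_zero_of_nonzeroCount (by simp) (by
      rw [nonzeroCount_cons_zero, nonzeroCount_cons one_ne_zero, nonzeroCount_replicate])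
  have h2 : Li 0 (fun _ : Fin 1 => r + 2) (fun _ => a) = -classicalCor (r + 1) (a : F) := by
    rw [classicalCor, trunc_cor_of_long (by simp)]
    simp [Li, iterInt, h1, classicalWord]
  rw [h2]
  exact neg_mem (Submodule.subset_span ⟨_, _, rfl⟩)

theorem coLie_le_tailSpan (hF : IsQuadraticallyClosed F)
    (hdepth : ∀ d, depthAll F d ≤ LinearMap.ker (iterCobracket F d)) (k : ℕ) :
    coLie (k + 1) (classicalGeTwo F) ≤ tailSpan F k := by
  rw [coLie, Submodule.span_le]
  rintro _ ⟨k', v, hk, hv, rfl⟩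
  obtain rfl : k' = k := by omega
  refine coLieWord_mem_of_mem_span ?_ v fun i => classicalGeTwo_le_span (hv i)
  intro v hv
  choose r y hry using hv
  rw [funext hry]
  exact coLieWord_classicalCor_mem hF hdepth k' r y

/-- The step of the induction on the depth: modulo smaller depth, everything of depth `k + 1` is a
combination of correlators with one block of zeros. -/
theorem depthPart_succ_le (hF : IsQuadraticallyClosed F) (hconj : DepthConjecture F) (k : ℕ)
    {n : ℕ} (hn : 2 ≤ n) : depthPart F (k + 1) n ≤
      Submodule.span ℚ {z | ∃ (x : Fin (k + 2) → Fˣ) (m : ℕ), k + 1 + m = n ∧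
        z = cor (tailWord x m)} ⊔ depthPart F k n := by
  intro x hx
  have hdepth : ∀ d, depthAll F d ≤ LinearMap.ker (iterCobracket F d) :=
    fun d x hx => (hconj.1 d x).1 hx
  obtain ⟨φ, hφ⟩ := hconj.2 (k + 1) (by omega)
  have hx2 : x ∈ depthGeTwo F (k + 1) :=
    Submodule.mem_iSup_of_mem n (Submodule.mem_iSup_of_mem hn hx)
  have hmem : iterCobracket F k x ∈ tailSpan F k := by
    have h := (φ (Submodule.Quotient.mk ⟨x, hx2⟩)).2
    rw [hφ] at h
    exact coLie_le_tailSpan hF hdepth k h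
  have hle : tailSpan F k ≤ (Submodule.span ℚ {z | ∃ (x : Fin (k + 2) → Fˣ) (m : ℕ),
      z = trunc F (cor (tailWord x m))}).map (iterCobracket F k) := by
    rw [tailSpan, Submodule.span_le]
    rintro _ ⟨x, m, rfl⟩
    exact ⟨_, Submodule.subset_span ⟨x, m, rfl⟩, rfl⟩
  obtain ⟨h, hh, hhx⟩ := hle hmem
  have hsub : x - h ∈ depthAll F k := by
    rw [hconj.1, map_sub, hhx, sub_self]
  have hproj := weightProj_mem_depthPart n hsub
  rw [map_sub, weightProj_of_mem_weightPart n n (depthPart_le_weightPart _ _ hx), if_pos rfl]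
    at hproj
  have hspan : Submodule.span ℚ {z | ∃ (x : Fin (k + 2) → Fˣ) (m : ℕ),
      z = trunc F (cor (tailWord x m))} ≤ (Submodule.span ℚ {z | ∃ (x : Fin (k + 2) → Fˣ) (m : ℕ),
        k + 1 + m = n ∧ z = cor (tailWord x m)}).comap (weightProj F n) := by
    rw [Submodule.span_le]
    rintro _ ⟨x, m, rfl⟩
    rw [SetLike.mem_coe, Submodule.mem_comap, trunc_cor]
    split_ifs
    · rw [weightProj_cor]
      split_ifs with hl
      · rw [length_tailWord] at hl
        exact Submodule.subset_span ⟨x, m, by omega, rfl⟩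
      · exact zero_mem _
    · rw [map_zero]
      exact zero_mem _
  rw [← add_sub_cancel (weightProj F n h) x]
  exact Submodule.add_mem_sup (hspan hh) hproj

theorem depthPart_succ_le_ones (hF : IsQuadraticallyClosed F) (hconj : DepthConjecture F) (k : ℕ)
    {n : ℕ} (hn : 2 ≤ n) : depthPart F (k + 1) n ≤
      Submodule.span ℚ {z | k + 1 ≤ n ∧ ∃ a : Fin (k + 1) → Fˣ, z = LiOnes n (k + 1) a} ⊔
        depthPart F k n := by
  refine (depthPart_succ_le hF hconj k hn).trans (sup_le ?_ le_sup_right)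
  rw [Submodule.span_le]
  rintro _ ⟨x, m, rfl, rfl⟩
  simpa using cor_tailWord_mem_ones hn x

theorem depthPart_succ_le_hook (hF : IsQuadraticallyClosed F) (hconj : DepthConjecture F) (k : ℕ)
    {n : ℕ} (hn : 2 ≤ n) : depthPart F (k + 1) n ≤
      Submodule.span ℚ {z | ∃ a : Fin (k + 1) → Fˣ, z = LiHook n (k + 1) a} ⊔
        depthPart F k n := by
  refine (depthPart_succ_le hF hconj k hn).trans (sup_le ?_ le_sup_right)
  rw [Submodule.span_le]
  rintro _ ⟨x, m, rfl, rfl⟩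
  exact cor_tailWord_mem_hook hn x

theorem depthPart_le_ones (hF : IsQuadraticallyClosed F) (hconj : DepthConjecture F) {n : ℕ}
    (hn : 2 ≤ n) (d : ℕ) : depthPart F d n ≤
      Submodule.span ℚ {x | ∃ (e : ℕ) (a : Fin e → Fˣ), 1 ≤ e ∧ e ≤ n ∧ x = LiOnes n e a} := by
  induction d with
  | zero => rw [depthPart_zero]; exact bot_le
  | succ k ih =>
    refine (depthPart_succ_le_ones hF hconj k hn).trans (sup_le (Submodule.span_mono ?_) ih)
    rintro _ ⟨hk, a, rfl⟩
    exact ⟨k + 1, a, by omega, hk, rfl⟩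

theorem depthPart_le_hook (hF : IsQuadraticallyClosed F) (hconj : DepthConjecture F) {n : ℕ}
    (hn : 2 ≤ n) (d : ℕ) : depthPart F d n ≤
      Submodule.span ℚ {x | ∃ (e : ℕ) (b : Fin e → Fˣ), 1 ≤ e ∧ e ≤ d ∧ x = LiHook n e b} := by
  induction d with
  | zero => rw [depthPart_zero]; exact bot_le
  | succ k ih =>
    refine (depthPart_succ_le_hook hF hconj k hn).trans (sup_le (Submodule.span_mono ?_)
      (ih.trans (Submodule.span_mono ?_)))
    · rintro _ ⟨a, rfl⟩
      exact ⟨k + 1, a, by omega, le_rfl, rfl⟩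
    · rintro _ ⟨e, b, h1, h2, rfl⟩
      exact ⟨e, b, h1, by omega, rfl⟩

/-! ### Weights zero and one -/

theorem LiOnes_mem_weightPart {n d : ℕ} (hd : d ≤ n) (a : Fin d → Fˣ) :
    LiOnes n d a ∈ weightPart F n := by
  have h := Li_mem_weightPart (n - d) (n := fun _ : Fin d => 1) (fun _ => le_rfl) a
  rwa [Finset.sum_const, Finset.card_univ, Fintype.card_fin, smul_eq_mul, mul_one,
    Nat.sub_add_cancel hd] at h

theorem weightPart_zero : weightPart F 0 = ⊥ := by
  rw [weightPart_eq_span, Submodule.span_eq_bot]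
  rintro _ ⟨l, hl, rfl⟩
  exact corMod_eq_zero (logRelation_mem (rel_le_allRel 0) (.short l hl.le))

/-- `Cor(0, c) = log c = -Li₁(1 - c)` for `c ≠ 1`, as `log (-1) = 0` rationally. -/
theorem weightPart_one_le : weightPart F 1 ≤
    Submodule.span ℚ {x | ∃ a : Fin 1 → Fˣ, x = LiOnes 1 1 a} := by
  have h0 := rel_le_allRel (F := F) 0
  rw [weightPart_eq_span, Submodule.span_le]
  rintro _ ⟨l, hl, rfl⟩
  obtain ⟨x, y, rfl⟩ := List.length_eq_two.1 hl
  have hxy : cor [x, y] = cor [0, y - x] := corMod_pair h0 x y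
  rw [hxy]
  by_cases h1 : y - x = 1
  · rw [h1, show cor [(0 : F), 1] = 0 from corMod_log_one h0]
    exact zero_mem _
  have ha : 1 - (y - x) ≠ 0 := fun h => h1 (sub_eq_zero.1 h).symm
  have hLi : LiOnes 1 1 (fun _ => Units.mk0 _ ha) = -cor [0, y - x] := by
    have e1 : cor [1, 1 - (y - x)] = cor [0, y - x] := by
      refine (corMod_pair h0 _ _).trans ?_
      rw [sub_sub_cancel_left, corMod_log_neg h0]
      rfl
    have e2 : cor [(0 : F), 1] = 0 := corMod_log_one h0
    simp [LiOnes, Li, iterInt, e1, e2]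
  rw [← neg_neg (cor _), ← hLi]
  exact neg_mem (Submodule.subset_span ⟨_, rfl⟩)

theorem LiOnes_one_eq_LiHook (a : Fin 1 → Fˣ) : LiOnes 1 1 a = LiHook 1 1 a := by
  rw [LiOnes, LiHook]
  congr 1
  ext i
  simp

end Spanning

end

end FormalPolylog

open FormalPolylog
theorem mainTheorem4 (F : Type u) [Field F] (hF : IsQuadraticallyClosed F)
    (hconj : DepthConjecture F) :
    (∀ n : ℕ, weightPart F n =
      Submodule.span ℚ {x | ∃ (d : ℕ) (a : Fin d → Fˣ), 1 ≤ d ∧ d ≤ n ∧ x = LiOnes n d a}) ∧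
    (∀ n d : ℕ, 1 ≤ d → d ≤ n → ∀ a : Fin d → Fˣ,
      LiOnes n d a ∈
        Submodule.span ℚ {x | ∃ b : Fin d → Fˣ, x = LiHook n d b} ⊔ depthPart F (d - 1) n) ∧
    (∀ (d n₀ : ℕ) (k : Fin d → ℕ), 1 ≤ d → (∀ i, 1 ≤ k i) → ∀ a : Fin d → Fˣ,
      Li n₀ k a ∈
        Submodule.span ℚ {x | ∃ (e : ℕ) (b : Fin e → Fˣ),
          1 ≤ e ∧ e ≤ d ∧ x = LiHook (n₀ + ∑ i, k i) e b}) := by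
  refine ⟨fun n => le_antisymm ?_ ?_, fun n d hd hdn a => ?_, fun d n₀ k hd hk a => ?_⟩
  · match n with
    | 0 => rw [weightPart_zero]; exact bot_le
    | 1 =>
      refine weightPart_one_le.trans (Submodule.span_mono ?_)
      rintro _ ⟨a, rfl⟩
      exact ⟨1, a, le_rfl, le_rfl, rfl⟩
    | n + 2 =>
      have hn : 2 ≤ n + 2 := Nat.le_add_left 2 n
      exact (weightPart_le_depthPart hn).trans (depthPart_le_ones hF hconj hn _)
  · rw [Submodule.span_le]
    rintro _ ⟨d, a, -, hd, rfl⟩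
    exact LiOnes_mem_weightPart hd a
  · obtain ⟨e, rfl⟩ : ∃ e, d = e + 1 := ⟨d - 1, by omega⟩
    by_cases hn : 2 ≤ n
    · refine depthPart_succ_le_hook hF hconj e hn ?_
      have h := Li_mem_depthPart (F := F) hd (n - (e + 1)) (k := fun _ => 1) (fun _ => le_rfl) a
      rwa [Finset.sum_const, Finset.card_univ, Fintype.card_fin, smul_eq_mul, mul_one,
        Nat.sub_add_cancel hdn] at h
    · obtain rfl : n = 1 := by omega
      obtain rfl : e = 0 := by omega
      exact Submodule.mem_sup_left (Submodule.subset_span ⟨a, LiOnes_one_eq_LiHook a⟩)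
  · by_cases hn : 2 ≤ n₀ + ∑ i, k i
    · exact depthPart_le_hook hF hconj hn d (Li_mem_depthPart hd n₀ hk a)
    · have hdk : d ≤ ∑ i, k i := by
        simpa using Finset.sum_le_sum fun i (_ : i ∈ Finset.univ) => hk i
      obtain rfl : d = 1 := by omega
      obtain rfl : n₀ = 0 := by omega
      have hk1 : k = fun _ => 1 := by
        ext i
        rw [Subsingleton.elim i 0]
        have := hk 0
        rw [Fin.sum_univ_one] at hn
        omega
      subst hk1
      refine Submodule.subset_span ⟨1, a, le_rfl, le_rfl, ?_⟩
      have h1 : 0 + ∑ _i : Fin 1, 1 = 1 := by simp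
      rw [h1]
      exact LiOnes_one_eq_LiHook a
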